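/- Let $r>0$ (in the model $0<r\le 1/4$; only $r>0$ is needed). Consider the delay system $$x'(t)=-x(t)+y(t)+\gamma f(x(t-\tau)),\qquad y'(t)=-r\,x(t),$$ with delay $\tau>0$, $f(0)=0$, $f$ differentiable at $0$. Its linearisation at the steady state $x=y=0$ is $$x'(t)=-x(t)+y(t)+b\,x(t-\tau),\qquad y'(t)=-r\,x(t),\qquad b=\gamma f'(0).$$ For all real $b$ and all $\tau>0$, its eigenvalues (the $\lambda\in\mathbb C$ for which $e^{\lambda t}c$ is a solution for some nonzero $c\in\mathbb C^2$) are exactly the roots of $$\lambda^2+\lambda+r-b\lambda e^{-\lambda\tau}=0. \qquad (*)$$ For $n=0,1,2,\dots$ let $I_0=(0,\pi/2)$, $I_n=\left(\frac{(2n-1)\pi}2,\frac{(2n+1)\pi}2\right)$ for $n\ge1$, and for $s\in I_n$ let $$\tau_C^n(s)=\frac{s}{2r}\left(\tan s+\sqrt{\tan^2 s+4r}\right),\qquad b_C^n(s)=\frac1{\cos s}.$$ Then $\tau_C^n(s)>0$, and $b_C^n(s)$ is positive for even $n$ and negative for odd $n$. 1. For all $\tau>0$ and $b\in\mathbb R$,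 $\lambda=0$ is not a root of $(*)$. For $\Omega\in\mathbb R$, $i\Omega$ is a root of $(*)$ if and only if, for some $n$, $s=|\Omega|\tau$ lies in $I_n$ and $(\tau,b)=(\tau_C^n(s),b_C^n(s))$. In particular $(*)$ has a root on the imaginary axis if and only if $(\tau,b)$ lies on one of these curves. 2. Let $s\in I_n$, $\tau=\tau_C^n(s)$, $b=b_C^n(s)$, $\Omega=s/\tau$. Each of the roots $\pm i\Omega$ of $(*)$ is simple. For fixed $\tau$ it belongs to a smooth branch $\lambda(\cdot)$ of roots, depending on the slope and defined near $b$, that contains all roots in a neighbourhood, and $$\mathrm{Re}\,\lambda'(b)=b\,\frac{\tau s(s+\cos s\sin s)+2s^2\cos^2 s}{\left|2s+\tau\tan s+\tau s(\cos s)^{-1}e^{-is}\right|^2}.$$ This is nonzero and has the sign of $b$. 3. Call $(\tau,b)$ a Hopf point if the roots of $(*)$ on the imaginary axis are exactly one pair $\pm i\Omega$, $\Omega>0$, and a double-Hopf point if they are exactly two different pairs $\pm i\Omega_1,\pm i\Omega_2$ with $0<\Omega_1<\Omega_2$; in both cases all these roots are required to be simple and to cross the imaginary axis with nonzero speed as $b$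 varies with $\tau$ fixed. For $\tau>0$, $(\tau,b)$ is a Hopf point if and only if it lies on exactly one of the curves, and a double-Hopf point if and only if it lies on two different curves. 4. Call the steady state stable if all eigenvalues have negative real part. For every $\tau>0$, as $b$ increases from $0$, the steady state loses stability at some $b_*>0$: it is stable for $0\le b<b_*$, and there is an eigenvalue with positive real part for all $b>b_*$ close to $b_*$. Either $(\tau,b_*)$ is a Hopf point, and exactly two eigenvalues have positive real part for all $b>b_*$ close to $b_*$, or it is a double-Hopf point, and exactly four do. The set $\tau^+$ of delays $\tau>0$ for which $(\tau,b_*)$ is a double-Hopf point is countably infinite, hence of Lebesgue measure zero, so for every delay $\tau\in(0,\infty)\setminus\tau^+$ stability is lost at a Hopf point. The same holds as $b$ decreases from $0$, with some $b_*<0$ (and $b_*<b\le0$ for stability, $b<b_*$ close to $b_*$ for instability) and a countably infinite set $\tau^-$ of measure zero. -/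

import Mathlib

open Set Filter Topology MeasureTheory
open scoped ContDiff

noncomputable section

namespace BandLimited

/-- Right-hand side of the delay system
`x'(t) = -x(t) + y(t) + γ f(x(t-τ))`, `y'(t) = -r x(t)`,
as a function of the triple `(x(t), y(t), x(t-τ))`. -/
def modelField (r γ : ℝ) (f : ℝ → ℝ) (p : ℝ × ℝ × ℝ) : ℝ × ℝ :=
  (-p.1 + p.2.1 + γ * f p.2.2, -r * p.1)

/-- Right-hand side of the linear delay system
`x'(t) = -x(t) + y(t) + b x(t-τ)`, `y'(t) = -r x(t)`,
as a function of `(x(t), y(t), x(t-τ))`, over any commutative ring. -/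
def linearField {R : Type*} [CommRing R] (r b : R) (p : R × R × R) : R × R :=
  (-p.1 + p.2.1 + b * p.2.2, -r * p.1)

/-- `(x, y)` is a (complex) solution of the linear delay system for `t ≥ 0`. -/
def IsLinearSolution (r τ b : ℝ) (x y : ℝ → ℂ) : Prop :=
  ∀ t : ℝ, 0 ≤ t →
    HasDerivAt (fun u => (x u, y u)) (linearField (r : ℂ) (b : ℂ) (x t, y t, x (t - τ))) t

/-- `z` is an eigenvalue of the linear delay system: for some nonzero vector `c`,
`t ↦ exp (z t) c` is a solution. -/
def IsEigenvalue (r τ b : ℝ) (z : ℂ) : Prop :=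
  ∃ c : ℂ × ℂ, c ≠ 0 ∧
    IsLinearSolution r τ b (fun t => c.1 * Complex.exp (z * t)) (fun t => c.2 * Complex.exp (z * t))

/-- The characteristic function `z² + z + r - b z exp (-z τ)`. -/
def characteristicFn (r τ b : ℝ) (z : ℂ) : ℂ :=
  z ^ 2 + z + r - b * z * Complex.exp (-(z * τ))

/-- The parameter interval of the `n`-th curve: `(0, π/2)` for `n = 0` and
`((2n-1)π/2, (2n+1)π/2)` for `n ≥ 1`. -/
def curveInterval (n : ℕ) : Set ℝ :=
  if n = 0 then Ioo 0 (Real.pi / 2)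
  else Ioo ((2 * (n : ℝ) - 1) * Real.pi / 2) ((2 * (n : ℝ) + 1) * Real.pi / 2)

/-- The delay along the curves. -/
def tauC (r s : ℝ) : ℝ :=
  s / (2 * r) * (Real.tan s + √(Real.tan s ^ 2 + 4 * r))

/-- The effective slope along the curves. -/
def bC (s : ℝ) : ℝ := 1 / Real.cos s

/-- The point `(τ, b)` lies on the `n`-th curve. -/
def OnCurve (r : ℝ) (n : ℕ) (τ b : ℝ) : Prop :=
  ∃ s ∈ curveInterval n, τ = tauC r s ∧ b = bC s

/-- The closed form of `Re (dλ/db)` at the point of parameter `s`. -/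
def crossingSpeed (r s : ℝ) : ℝ :=
  bC s * ((tauC r s * s * (s + Real.cos s * Real.sin s) + 2 * s ^ 2 * Real.cos s ^ 2) /
    ‖(2 * s + tauC r s * Real.tan s : ℂ) +
      tauC r s * s * ((Real.cos s : ℝ) : ℂ)⁻¹ * Complex.exp (-(Complex.I * s))‖ ^ 2)

/-- `z` is a simple characteristic root. -/
def IsSimpleRoot (r τ b : ℝ) (z : ℂ) : Prop :=
  characteristicFn r τ b z = 0 ∧ deriv (characteristicFn r τ b) z ≠ 0

/-- `ℓ` is a smooth branch of characteristic roots through `z` at the slope `b` (the delay being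
fixed), and near `(b, z)` there are no other characteristic roots. -/
def IsRootBranch (r τ b : ℝ) (z : ℂ) (l : ℝ → ℂ) : Prop :=
  ContDiffAt ℝ ∞ l b ∧ l b = z ∧
    ∀ᶠ p : ℝ × ℂ in 𝓝 (b, z), (characteristicFn r τ p.1 p.2 = 0 ↔ p.2 = l p.1)

/-- The characteristic root `z` lies on the imaginary axis and crosses it with nonzero speed
as the slope passes through `b`. -/
def CrossesTransversally (r τ b : ℝ) (z : ℂ) : Prop :=
  z.re = 0 ∧ ∃ l : ℝ → ℂ, IsRootBranch r τ b z l ∧ (deriv l b).re ≠ 0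

/-- The set of characteristic roots on the imaginary axis. -/
def imagRoots (r τ b : ℝ) : Set ℂ := {z | characteristicFn r τ b z = 0 ∧ z.re = 0}

/-- The set of characteristic roots in the open right half-plane. -/
def unstableRoots (r τ b : ℝ) : Set ℂ := {z | characteristicFn r τ b z = 0 ∧ 0 < z.re}

/-- Conditions for a Hopf bifurcation (parameter `b`, fixed delay `τ`): there is exactly one pair
`±iΩ` of characteristic roots on the imaginary axis, the two roots are simple, and they cross
the axis transversally. -/
def IsHopfPoint (r τ b : ℝ) : Prop :=
  ∃ Ω : ℝ, 0 < Ω ∧ imagRoots r τ b = {Ω * Complex.I, -(Ω * Complex.I)} ∧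
    ∀ z ∈ imagRoots r τ b, IsSimpleRoot r τ b z ∧ CrossesTransversally r τ b z

/-- Double-Hopf points: there are exactly two different pairs `±iΩ₁`, `±iΩ₂` of characteristic
roots on the imaginary axis, and all four roots are simple and cross transversally. -/
def IsDoubleHopfPoint (r τ b : ℝ) : Prop :=
  ∃ Ω₁ Ω₂ : ℝ, 0 < Ω₁ ∧ Ω₁ < Ω₂ ∧
    imagRoots r τ b =
      {Ω₁ * Complex.I, -(Ω₁ * Complex.I), Ω₂ * Complex.I, -(Ω₂ * Complex.I)} ∧
    ∀ z ∈ imagRoots r τ b, IsSimpleRoot r τ b z ∧ CrossesTransversally r τ b z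

/-- The steady state is (linearly) stable: all eigenvalues of the linearised delay system
have negative real part. -/
def IsStable (r τ b : ℝ) : Prop := ∀ z : ℂ, IsEigenvalue r τ b z → z.re < 0

/-- As the slope increases from `0`, the steady state loses stability at the value `b > 0`. -/
def LosesStabilityUp (r τ b : ℝ) : Prop :=
  0 < b ∧ (∀ b' ∈ Ico 0 b, IsStable r τ b') ∧
    ∀ᶠ b' in 𝓝[>] b, ∃ z : ℂ, IsEigenvalue r τ b' z ∧ 0 < z.re

/-- As the slope decreases from `0`, the steady state loses stability at the value `b < 0`. -/
def LosesStabilityDown (r τ b : ℝ) : Prop :=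
  b < 0 ∧ (∀ b' ∈ Ioc b 0, IsStable r τ b') ∧
    ∀ᶠ b' in 𝓝[<] b, ∃ z : ℂ, IsEigenvalue r τ b' z ∧ 0 < z.re

/-- The delays at which stability is lost at a double-Hopf point as the slope increases. -/
def tauPlus (r : ℝ) : Set ℝ :=
  {τ | 0 < τ ∧ ∃ b, LosesStabilityUp r τ b ∧ IsDoubleHopfPoint r τ b}

/-- The delays at which stability is lost at a double-Hopf point as the slope decreases. -/
def tauMinus (r : ℝ) : Set ℝ :=
  {τ | 0 < τ ∧ ∃ b, LosesStabilityDown r τ b ∧ IsDoubleHopfPoint r τ b}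

end BandLimited

end

open BandLimited

namespace BandLimited

/-! For `z ≠ 0` the characteristic equation can be solved for the slope: it reads `slopeFn r τ z =
b`, with a holomorphic left side independent of `b`. Root branches are local inverses of `slopeFn`.

At `z = iΩ`, with `s = Ωτ > 0`, the imaginary part gives `b cos s = 1`, and the quotient of the two
parts gives `tan s = rτ/s - s/τ` (`tanValue`), a quadratic in `τ` whose only positive root is
`tauC`. An explicit velocity shows that every imaginary root is simple and moves right as `|b|`
grows.

On the curves `b² = 1 + tanValue²`. Since `tanValue` is strictly decreasing in `s`, a point lies on
at most two curves, and at a meeting the two tangents are opposite (`tanValue_neg_of_meet`,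
`not_three_curves`).

At `b = 0` all roots lie in the left half-plane. Roots in the closed right half-plane are bounded,
so stability is an open condition; instability is open by the open mapping theorem. By connectedness
stability persists until `b` first meets a curve, and beyond it the unstable roots are exactly the
continued imaginary ones (`eventually_ncard_unstableRoots`).

Where curves `n` and `m` meet, the parameters have the fixed sum `(n + m)π`, although both increase
with `τ`; so there is at most one such delay, and double-Hopf delays are countable. Curves `N` and
`N + 2` with `N ≥ 1` do meet, at the smallest `|b|` for their parity, which gives infinitely many
(`exists_extremal_meet`). -/

/-! ### Linearisation and characteristic equation -/

theorem modelField_linearisation (r γ : ℝ) (f : ℝ → ℝ) (h0 : f 0 = 0)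
    (hf : DifferentiableAt ℝ f 0) :
    modelField r γ f 0 = 0 ∧
      ∃ A : ℝ × ℝ × ℝ →L[ℝ] ℝ × ℝ, HasFDerivAt (modelField r γ f) A 0 ∧
        ∀ p, A p = linearField r (γ * deriv f 0) p := by
  refine ⟨by simp [modelField, h0], ?_⟩
  let p1 : ℝ × ℝ × ℝ →L[ℝ] ℝ := ContinuousLinearMap.fst ℝ ℝ (ℝ × ℝ)
  let p2 : ℝ × ℝ × ℝ →L[ℝ] ℝ :=
    (ContinuousLinearMap.fst ℝ ℝ ℝ).comp (ContinuousLinearMap.snd ℝ ℝ (ℝ × ℝ))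
  let p3 : ℝ × ℝ × ℝ →L[ℝ] ℝ :=
    (ContinuousLinearMap.snd ℝ ℝ ℝ).comp (ContinuousLinearMap.snd ℝ ℝ (ℝ × ℝ))
  have h3 : HasFDerivAt (fun p : ℝ × ℝ × ℝ => f p.2.2) (deriv f 0 • p3) 0 :=
    HasDerivAt.comp_hasFDerivAt (h₂ := f) (f := fun p : ℝ × ℝ × ℝ => p.2.2) 0 hf.hasDerivAt
      p3.hasFDerivAt
  refine ⟨((-p1 + p2) + γ • (deriv f 0 • p3)).prod ((-r) • p1), ?_, ?_⟩
  · exact ((p1.hasFDerivAt.neg.add p2.hasFDerivAt).add (h3.const_mul γ)).prodMk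
      (p1.hasFDerivAt.const_mul (-r))
  · intro p
    simp [linearField, p1, p2, p3, mul_assoc]

theorem characteristicFn_zero_ne {r : ℝ} (hr : 0 < r) (τ b : ℝ) :
    characteristicFn r τ b 0 ≠ 0 := by
  simp [characteristicFn, hr.ne']

theorem hasDerivAt_const_mul_exp (c z : ℂ) (t : ℝ) :
    HasDerivAt (fun u : ℝ => c * Complex.exp (z * u)) (c * (Complex.exp (z * t) * z)) t := by
  have h1 : HasDerivAt (fun u : ℝ => z * (u : ℂ)) z t := by
    simpa using (Complex.ofRealCLM.hasDerivAt (x := t)).const_mul z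
  exact (h1.cexp).const_mul c

theorem isEigenvalue_iff {r : ℝ} (hr : 0 < r) (τ b : ℝ) (z : ℂ) :
    IsEigenvalue r τ b z ↔ characteristicFn r τ b z = 0 := by
  have hd (c : ℂ × ℂ) (t : ℝ) := (hasDerivAt_const_mul_exp c.1 z t).prodMk
    (hasDerivAt_const_mul_exp c.2 z t)
  constructor
  · rintro ⟨c, hc, h⟩
    have h0 := (h 0 le_rfl).unique (hd c 0)
    simp only [linearField, Prod.mk.injEq] at h0
    obtain ⟨e1, e2⟩ := h0
    simp only [Complex.ofReal_zero, mul_zero, Complex.exp_zero, mul_one, one_mul, zero_sub,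
      Complex.ofReal_neg, mul_neg] at e1 e2
    have hc1 : c.1 ≠ 0 := by
      intro h1
      apply hc
      rw [h1] at e1
      ext
      · exact h1
      · simpa using e1
    have : c.1 * characteristicFn r τ b z = 0 := by
      unfold characteristicFn
      -- Eliminates `c.2` between the two components of the equation at `t = 0`.
      linear_combination -z * e1 - e2
    exact (mul_eq_zero.1 this).resolve_left hc1
  · intro h
    have hz : z ≠ 0 := by
      rintro rfl
      exact characteristicFn_zero_ne hr τ b h
    -- The second equation requires `z * c.2 = -r * c.1`.
    refine ⟨(z, -r), by simp [hz], fun t _ => ?_⟩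
    convert hd (z, -r) t using 1
    simp only [linearField, Prod.mk.injEq]
    constructor
    · have : Complex.exp (z * ((t - τ : ℝ) : ℂ)) = Complex.exp (z * t) * Complex.exp (-(z * τ)) := by
        rw [← Complex.exp_add]
        push_cast
        ring_nf
      rw [this]
      unfold characteristicFn at h
      linear_combination (-Complex.exp (z * t)) * h
    · ring

/-! ### Parameter intervals and the sign of the slope -/

theorem pos_of_mem_curveInterval {n : ℕ} {s : ℝ} (h : s ∈ curveInterval n) : 0 < s := by
  unfold curveInterval at h
  split_ifs at h with hn
  · exact h.1
  · have : (1 : ℝ) ≤ n := by exact_mod_cast Nat.one_le_iff_ne_zero.2 hn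
    refine lt_trans ?_ h.1
    have := Real.pi_pos
    have : 0 < 2 * (n : ℝ) - 1 := by linarith
    positivity

/-- Treats all indices uniformly: a shift by `nπ` leads to the principal branch of the tangent, and
positivity only cuts off the left half for `n = 0`. -/
theorem mem_curveInterval_iff {n : ℕ} {s : ℝ} :
    s ∈ curveInterval n ↔
      0 < s ∧ s - n * Real.pi ∈ Ioo (-(Real.pi / 2)) (Real.pi / 2) := by
  constructor
  · intro h
    refine ⟨pos_of_mem_curveInterval h, ?_⟩
    unfold curveInterval at h
    split_ifs at h with hn
    · subst hn
      have := Real.pi_pos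
      constructor <;> simp <;> linarith [h.1, h.2]
    · constructor <;> nlinarith [h.1, h.2]
  · rintro ⟨h0, h1, h2⟩
    unfold curveInterval
    split_ifs with hn
    · subst hn
      simp at h2
      exact ⟨h0, h2⟩
    · constructor <;> nlinarith

theorem cos_eq_neg_one_pow_mul (n : ℕ) (s : ℝ) :
    Real.cos s = (-1) ^ n * Real.cos (s - n * Real.pi) := by
  rw [Real.cos_sub_nat_mul_pi, ← mul_assoc, ← mul_pow]
  simp

theorem cos_shift_pos {n : ℕ} {s : ℝ} (h : s ∈ curveInterval n) :
    0 < Real.cos (s - n * Real.pi) :=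
  Real.cos_pos_of_mem_Ioo (mem_curveInterval_iff.1 h).2

theorem cos_ne_zero_of_mem {n : ℕ} {s : ℝ} (h : s ∈ curveInterval n) : Real.cos s ≠ 0 := by
  rw [cos_eq_neg_one_pow_mul n]
  exact mul_ne_zero (pow_ne_zero _ (by norm_num)) (cos_shift_pos h).ne'

theorem bC_eq (n : ℕ) (s : ℝ) : bC s = (-1) ^ n * (1 / Real.cos (s - n * Real.pi)) := by
  unfold bC
  rw [cos_eq_neg_one_pow_mul n, one_div, one_div, mul_inv, ← inv_pow]
  norm_num

theorem bC_pos_of_even {n : ℕ} {s : ℝ} (h : s ∈ curveInterval n) (hn : Even n) : 0 < bC s := by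
  rw [bC_eq n, hn.neg_one_pow, one_mul]
  exact one_div_pos.2 (cos_shift_pos h)

theorem bC_neg_of_odd {n : ℕ} {s : ℝ} (h : s ∈ curveInterval n) (hn : Odd n) : bC s < 0 := by
  rw [bC_eq n, hn.neg_one_pow]
  have := one_div_pos.2 (cos_shift_pos h)
  linarith

theorem exists_mem_curveInterval {s : ℝ} (hs : 0 < s) (hc : Real.cos s ≠ 0) :
    ∃ n, s ∈ curveInterval n := by
  have hpi := Real.pi_pos
  -- The integer nearest to `s / π`; a tie would mean `cos s = 0`.
  set n := ⌊s / Real.pi + 1 / 2⌋₊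
  have h1 : (n : ℝ) ≤ s / Real.pi + 1 / 2 := Nat.floor_le (by positivity)
  have h2 : s / Real.pi + 1 / 2 < n + 1 := Nat.lt_floor_add_one _
  refine ⟨n, mem_curveInterval_iff.2 ⟨hs, ?_, ?_⟩⟩
  · have h3 : -(Real.pi / 2) ≤ s - n * Real.pi := by
      have := mul_le_mul_of_nonneg_right h1 hpi.le
      rw [add_mul, div_mul_cancel₀ _ hpi.ne'] at this
      linarith
    refine lt_of_le_of_ne h3 fun h4 => hc ?_
    rw [cos_eq_neg_one_pow_mul n, ← h4, Real.cos_neg, Real.cos_pi_div_two, mul_zero]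
  · have := mul_lt_mul_of_pos_right h2 hpi
    rw [add_mul, div_mul_cancel₀ _ hpi.ne'] at this
    linarith

theorem curveInterval_index_unique {n m : ℕ} {s : ℝ} (hn : s ∈ curveInterval n)
    (hm : s ∈ curveInterval m) : n = m := by
  obtain ⟨-, a1, a2⟩ := mem_curveInterval_iff.1 hn
  obtain ⟨-, c1, c2⟩ := mem_curveInterval_iff.1 hm
  have hpi := Real.pi_pos
  have h1 : (n : ℝ) < m + 1 := by
    by_contra! h
    nlinarith
  have h2 : (m : ℝ) < n + 1 := by
    by_contra! h
    nlinarith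
  have h1' : n < m + 1 := by exact_mod_cast h1
  have h2' : m < n + 1 := by exact_mod_cast h2
  omega

/-! ### Imaginary roots and the curves -/

theorem abs_tan_lt_sqrt {r : ℝ} (hr : 0 < r) (t : ℝ) : |t| < √(t ^ 2 + 4 * r) := by
  rw [← Real.sqrt_sq_eq_abs]
  exact Real.sqrt_lt_sqrt (sq_nonneg _) (by linarith)

theorem add_sqrt_pos {r : ℝ} (hr : 0 < r) (t : ℝ) : 0 < t + √(t ^ 2 + 4 * r) := by
  linarith [abs_tan_lt_sqrt hr t, neg_abs_le t]

theorem tauC_pos {r s : ℝ} (hr : 0 < r) (hs : 0 < s) : 0 < tauC r s :=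
  mul_pos (by positivity) (add_sqrt_pos hr _)

/-- Cleared of denominators, the tangent equation is `rτ² - s tan s · τ - s² = 0`. Its roots in `τ`
have opposite signs, and `tauC` is the positive one. -/
theorem eq_tauC_iff {r τ s : ℝ} (hr : 0 < r) (hτ : 0 < τ) (hs : 0 < s) :
    τ = tauC r s ↔ Real.tan s = r * τ / s - s / τ := by
  have hq := Real.sq_sqrt (show 0 ≤ Real.tan s ^ 2 + 4 * r by positivity)
  have hp := add_sqrt_pos hr (Real.tan s)
  have hm := abs_tan_lt_sqrt hr (Real.tan s)
  have hm' := le_abs_self (Real.tan s)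
  unfold tauC
  set t := Real.tan s
  set q := √(t ^ 2 + 4 * r)
  have e1 : (t = r * τ / s - s / τ) ↔ t * s * τ = r * τ ^ 2 - s ^ 2 := by
    field_simp
  have e2 : (τ = s / (2 * r) * (t + q)) ↔ 2 * r * τ = s * (t + q) := by
    field_simp
  rw [e1, e2]
  have key : (2 * r * τ - s * (t + q)) * (2 * r * τ - s * (t - q)) =
      4 * r * (r * τ ^ 2 - s ^ 2 - t * s * τ) := by
    linear_combination (-s ^ 2) * hq
  have hpos : 0 < 2 * r * τ - s * (t - q) := by
    have : 0 < s * (q - t) := mul_pos hs (by linarith)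
    have : 0 < 2 * r * τ := by positivity
    linarith
  constructor
  · intro h
    rw [h, sub_self, zero_mul] at key
    have : r * τ ^ 2 - s ^ 2 - t * s * τ = 0 := by
      have := mul_eq_zero.1 key.symm
      exact this.resolve_left (by positivity)
    linarith
  · intro h
    rw [h] at key
    have : (2 * r * τ - s * (t + q)) * (2 * r * τ - s * (t - q)) = 0 := by rw [key]; ring
    have := (mul_eq_zero.1 this).resolve_right hpos.ne'
    linarith

/-- `iΩ` is a characteristic root iff the real and imaginary parts vanish. -/
theorem characteristicFn_ofReal_mul_I (r τ b Ω : ℝ) :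
    characteristicFn r τ b (Ω * Complex.I) = 0 ↔
      r - Ω ^ 2 = b * Ω * Real.sin (Ω * τ) ∧ Ω = b * Ω * Real.cos (Ω * τ) := by
  have he : Complex.exp (-(Ω * Complex.I * τ)) =
      (Real.cos (Ω * τ) : ℂ) - Real.sin (Ω * τ) * Complex.I := by
    rw [show -(Ω * Complex.I * τ : ℂ) = ((-(Ω * τ) : ℝ) : ℂ) * Complex.I by push_cast; ring,
      Complex.exp_mul_I, ← Complex.ofReal_cos, ← Complex.ofReal_sin, Real.cos_neg, Real.sin_neg]
    push_cast
    ring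
  have : characteristicFn r τ b (Ω * Complex.I) =
      ((r - Ω ^ 2 - b * Ω * Real.sin (Ω * τ) : ℝ) : ℂ) +
        ((Ω - b * Ω * Real.cos (Ω * τ) : ℝ) : ℂ) * Complex.I := by
    unfold characteristicFn
    rw [he]
    push_cast
    linear_combination ((Ω : ℂ) ^ 2 + b * Ω * Complex.sin (Ω * τ)) * Complex.I_sq
  rw [this, Complex.ext_iff]
  simp [-Complex.ofReal_sub, sub_eq_zero]

theorem characteristicFn_abs (r τ b Ω : ℝ) :
    characteristicFn r τ b (Ω * Complex.I) = 0 ↔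
      characteristicFn r τ b ((|Ω| : ℝ) * Complex.I) = 0 := by
  rcases abs_choice Ω with h | h
  · rw [h]
  · rw [h, characteristicFn_ofReal_mul_I, characteristicFn_ofReal_mul_I]
    simp only [neg_mul, Real.sin_neg, Real.cos_neg, neg_sq, mul_neg, neg_neg, neg_inj]

/-- The imaginary part says `b cos(Ωτ) = 1`, so the cosine cannot vanish; substituting this `b` in
the real part leaves the tangent equation for `s = Ωτ`. -/
theorem characteristicFn_pos_iff {r τ b Ω : ℝ} (hr : 0 < r) (hτ : 0 < τ) (hΩ : 0 < Ω) :
    characteristicFn r τ b (Ω * Complex.I) = 0 ↔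
      ∃ n : ℕ, Ω * τ ∈ curveInterval n ∧ τ = tauC r (Ω * τ) ∧ b = bC (Ω * τ) := by
  rw [characteristicFn_ofReal_mul_I]
  have hs : 0 < Ω * τ := by positivity
  have hb (hc : Real.cos (Ω * τ) ≠ 0) :
      b = bC (Ω * τ) ↔ Ω = b * Ω * Real.cos (Ω * τ) := by
    unfold bC
    rw [eq_div_iff hc]
    constructor
    · intro h
      linear_combination (-Ω) * h
    · intro h
      exact mul_left_cancel₀ hΩ.ne' (by linear_combination -h)
  have ht (hc : Real.cos (Ω * τ) ≠ 0) (h : b = bC (Ω * τ)) :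
      τ = tauC r (Ω * τ) ↔ r - Ω ^ 2 = b * Ω * Real.sin (Ω * τ) := by
    rw [eq_tauC_iff hr hτ hs, h, bC, Real.tan_eq_sin_div_cos]
    generalize Real.sin (Ω * τ) = S at *
    generalize Real.cos (Ω * τ) = C at *
    field_simp
    constructor <;> intro h <;> linarith
  constructor
  · rintro ⟨h1, h2⟩
    have hc : Real.cos (Ω * τ) ≠ 0 := by
      intro h
      rw [h, mul_zero] at h2
      exact hΩ.ne' h2
    obtain ⟨n, hn⟩ := exists_mem_curveInterval hs hc
    have hb' := (hb hc).2 h2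
    exact ⟨n, hn, (ht hc hb').2 h1, hb'⟩
  · rintro ⟨n, hn, h1, h2⟩
    have hc := cos_ne_zero_of_mem hn
    exact ⟨(ht hc h2).1 h1, (hb hc).1 h2⟩

theorem characteristicFn_imag_iff {r τ : ℝ} (hr : 0 < r) (hτ : 0 < τ) (b Ω : ℝ) :
    characteristicFn r τ b (Ω * Complex.I) = 0 ↔
      ∃ n : ℕ, |Ω| * τ ∈ curveInterval n ∧ τ = tauC r (|Ω| * τ) ∧ b = bC (|Ω| * τ) := by
  rcases eq_or_ne Ω 0 with rfl | h
  · simp only [Complex.ofReal_zero, zero_mul, characteristicFn_zero_ne hr, abs_zero, false_iff]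
    rintro ⟨n, hn, -⟩
    exact (pos_of_mem_curveInterval hn).false
  · rw [characteristicFn_abs, characteristicFn_pos_iff hr hτ (abs_pos.2 h)]

theorem eq_im_mul_I {z : ℂ} (h : z.re = 0) : z = (z.im : ℂ) * Complex.I := by
  apply Complex.ext <;> simp [h]

theorem mem_imagRoots_iff {r τ b : ℝ} (hr : 0 < r) (hτ : 0 < τ) {z : ℂ} :
    z ∈ imagRoots r τ b ↔ ∃ n : ℕ, ∃ s ∈ curveInterval n, τ = tauC r s ∧ b = bC s ∧
      (z = ((s / τ : ℝ) : ℂ) * Complex.I ∨ z = -(((s / τ : ℝ) : ℂ) * Complex.I)) := by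
  constructor
  · rintro ⟨h1, h2⟩
    rw [eq_im_mul_I h2, characteristicFn_imag_iff hr hτ] at h1
    obtain ⟨n, hn, h3, h4⟩ := h1
    refine ⟨n, _, hn, h3, h4, ?_⟩
    rw [mul_div_cancel_right₀ _ hτ.ne']
    rcases abs_choice z.im with h | h
    · left
      rw [h]
      exact eq_im_mul_I h2
    · right
      rw [h]
      conv_lhs => rw [eq_im_mul_I h2]
      push_cast
      ring
  · rintro ⟨n, s, hn, h1, h2, h⟩
    have hs := pos_of_mem_curveInterval hn
    have key (Ω : ℝ) (hΩ : |Ω| = s / τ) : characteristicFn r τ b (Ω * Complex.I) = 0 := by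
      rw [characteristicFn_imag_iff hr hτ]
      refine ⟨n, ?_⟩
      rw [hΩ, div_mul_cancel₀ _ hτ.ne']
      exact ⟨hn, h1, h2⟩
    have hp : |s / τ| = s / τ := abs_of_pos (by positivity)
    rcases h with rfl | rfl
    · exact ⟨key _ hp, by simp⟩
    · refine ⟨?_, by simp⟩
      have := key (-(s / τ)) (by rw [abs_neg, hp])
      simpa using this

theorem exists_imagRoot_iff {r τ : ℝ} (hr : 0 < r) (hτ : 0 < τ) (b : ℝ) :
    (∃ z : ℂ, characteristicFn r τ b z = 0 ∧ z.re = 0) ↔ ∃ n : ℕ, OnCurve r n τ b := by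
  constructor
  · rintro ⟨z, hz⟩
    obtain ⟨n, s, hs, h1, h2, -⟩ := (mem_imagRoots_iff hr hτ).1 hz
    exact ⟨n, s, hs, h1, h2⟩
  · rintro ⟨n, s, hs, h1, h2⟩
    exact ⟨_, (mem_imagRoots_iff hr hτ).2 ⟨n, s, hs, h1, h2, Or.inl rfl⟩⟩

/-! ### Root branches as local inverses of the slope function -/

/-- The slope for which a nonzero `z` is a characteristic root. -/
noncomputable def slopeFn (r τ : ℝ) (z : ℂ) : ℂ := (z ^ 2 + z + r) * Complex.exp (z * τ) / z

theorem characteristicFn_eq_zero_iff_slopeFn {r τ b : ℝ} {z : ℂ} (hz : z ≠ 0) :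
    characteristicFn r τ b z = 0 ↔ slopeFn r τ z = b := by
  have he : Complex.exp (-(z * τ)) * Complex.exp (z * τ) = 1 := by
    rw [← Complex.exp_add, neg_add_cancel, Complex.exp_zero]
  unfold characteristicFn slopeFn
  rw [div_eq_iff hz]
  constructor
  · intro h
    linear_combination Complex.exp (z * τ) * h + b * z * he
  · intro h
    linear_combination Complex.exp (-(z * τ)) * h - (z ^ 2 + z + r) * he

theorem hasDerivAt_exp_mul (τ z : ℂ) :
    HasDerivAt (fun w : ℂ => Complex.exp (w * τ)) (Complex.exp (z * τ) * τ) z := by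
  have := ((hasDerivAt_id z).mul_const τ).cexp
  simpa using this

theorem hasDerivAt_characteristicFn (r τ b : ℝ) (z : ℂ) :
    HasDerivAt (characteristicFn r τ b)
      (2 * z + 1 - b * Complex.exp (-(z * τ)) + b * τ * z * Complex.exp (-(z * τ))) z := by
  have h1 := hasDerivAt_exp_mul (-τ) z
  simp only [mul_neg] at h1
  have h2 := (((hasDerivAt_id z).const_mul (b : ℂ)).mul h1)
  have h3 := ((((hasDerivAt_id z).pow 2).add (hasDerivAt_id z)).add_const (r : ℂ)).sub h2
  refine h3.congr_deriv ?_
  simp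
  ring

theorem hasDerivAt_slopeFn (r τ : ℝ) {z : ℂ} (hz : z ≠ 0) :
    HasDerivAt (slopeFn r τ)
      ((((2 * z + 1) + (z ^ 2 + z + r) * τ) * z - (z ^ 2 + z + r)) *
        Complex.exp (z * τ) / z ^ 2) z := by
  have h3 := ((((hasDerivAt_id z).pow 2).add (hasDerivAt_id z)).add_const (r : ℂ))
  have h4 := (h3.mul (hasDerivAt_exp_mul τ z)).div (hasDerivAt_id z) hz
  refine h4.congr_deriv ?_
  simp
  ring

theorem contDiffAt_slopeFn (r τ : ℝ) {z : ℂ} (hz : z ≠ 0) {n : WithTop ℕ∞} :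
    ContDiffAt ℂ n (slopeFn r τ) z := by
  unfold slopeFn
  refine ContDiffAt.div ?_ contDiffAt_id hz
  fun_prop

/-- The characteristic function equals `(slopeFn - b) z exp(-zτ)`, and at a root the product rule
leaves one term. Hence at a simple root `slopeFn` is locally invertible. -/
theorem hasDerivAt_slopeFn_of_root {r τ b : ℝ} {z : ℂ} (hz : z ≠ 0)
    (h : characteristicFn r τ b z = 0) :
    HasDerivAt (slopeFn r τ)
      (deriv (characteristicFn r τ b) z / (z * Complex.exp (-(z * τ)))) z := by
  refine (hasDerivAt_slopeFn r τ hz).congr_deriv ?_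
  rw [(hasDerivAt_characteristicFn r τ b z).deriv]
  have he : Complex.exp (z * τ) = (Complex.exp (-(z * τ)))⁻¹ := by
    rw [← Complex.exp_neg, neg_neg]
  have he0 := Complex.exp_ne_zero (-(z * τ))
  unfold characteristicFn at h
  rw [he]
  generalize Complex.exp (-(z * τ)) = e at *
  field_simp
  linear_combination (τ * z - 1) * h

/-- The branch is the local inverse of `slopeFn` restricted to real slopes; local injectivity rules
out other nearby roots. -/
theorem exists_rootBranch {r τ b : ℝ} {z : ℂ} (hz : z ≠ 0) (h : IsSimpleRoot r τ b z) :
    ∃ l : ℝ → ℂ, IsRootBranch r τ b z l ∧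
      HasDerivAt l (z * Complex.exp (-(z * τ)) / deriv (characteristicFn r τ b) z) b := by
  obtain ⟨h0, hD⟩ := h
  have he0 := Complex.exp_ne_zero (-(z * τ))
  have hd := hasDerivAt_slopeFn_of_root hz h0
  set D := deriv (characteristicFn r τ b) z / (z * Complex.exp (-(z * τ))) with hDdef
  have hD0 : D ≠ 0 := div_ne_zero hD (mul_ne_zero hz he0)
  have hstrict : HasStrictDerivAt (slopeFn r τ) D z :=
    (contDiffAt_slopeFn r τ hz (n := 1)).hasStrictDerivAt' hd one_ne_zero
  have hF := hstrict.hasStrictFDerivAt_equiv hD0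
  let e := hF.toOpenPartialHomeomorph (slopeFn r τ)
  have hsrc : z ∈ e.source := hF.mem_toOpenPartialHomeomorph_source
  have hez : e z = (b : ℂ) := (characteristicFn_eq_zero_iff_slopeFn hz).1 h0
  have htgt : (b : ℂ) ∈ e.target := hez ▸ e.map_source hsrc
  have hsymm : e.symm (b : ℂ) = z := by rw [← hez, e.left_inv hsrc]
  have hd' : HasDerivAt e D (e.symm (b : ℂ)) := by rw [hsymm]; exact hd
  have hof : HasDerivAt (fun x : ℝ => (x : ℂ)) 1 b := Complex.ofRealCLM.hasDerivAt
  refine ⟨fun x => e.symm (x : ℂ), ⟨?_, hsymm, ?_⟩, ?_⟩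
  · have h1 : ContDiffAt ℂ ∞ e.symm (b : ℂ) :=
      e.contDiffAt_symm_deriv hD0 htgt hd' (by rw [hsymm]; exact contDiffAt_slopeFn r τ hz)
    exact (h1.restrict_scalars ℝ).comp b Complex.ofRealCLM.contDiff.contDiffAt
  · have h1 : ∀ᶠ p : ℝ × ℂ in 𝓝 (b, z), p.2 ∈ e.source :=
      continuousAt_snd.eventually (e.open_source.mem_nhds hsrc)
    have h2 : ∀ᶠ p : ℝ × ℂ in 𝓝 (b, z), (p.1 : ℂ) ∈ e.target :=
      (Complex.continuous_ofReal.comp continuous_fst).continuousAt.eventually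
        (e.open_target.mem_nhds htgt)
    have h3 : ∀ᶠ p : ℝ × ℂ in 𝓝 (b, z), p.2 ≠ 0 :=
      continuousAt_snd.eventually_ne hz
    filter_upwards [h1, h2, h3] with p p1 p2 p3
    rw [characteristicFn_eq_zero_iff_slopeFn p3]
    exact e.eq_symm_apply p1 p2 |>.symm
  · have h1 := (e.hasDerivAt_symm htgt hD0 hd').comp_ofReal
    refine h1.congr_deriv ?_
    rw [hDdef, inv_div]

/-! ### Simplicity and crossing speed -/

/-- This is `|sin 2w| < |2w|`. The expression is even in `w`, so that both conjugate roots are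
covered. -/
theorem mul_add_cos_mul_sin_pos {w : ℝ} (hw : w ≠ 0) :
    0 < w * (w + Real.cos w * Real.sin w) := by
  have h (x : ℝ) (hx : 0 < x) : 0 < x * (x + Real.cos x * Real.sin x) := by
    refine mul_pos hx ?_
    have h1 := Real.abs_sin_lt_abs (show 2 * x ≠ 0 by positivity)
    rw [abs_of_pos (show 0 < 2 * x by positivity), Real.sin_two_mul] at h1
    linarith [(abs_lt.1 h1).1]
  rcases hw.lt_or_gt with h1 | h1
  · have := h (-w) (by linarith)
    rw [Real.cos_neg, Real.sin_neg] at this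
    linarith
  · exact h w h1

theorem crossing_numerator_pos {τ w : ℝ} (hτ : 0 < τ) (hw : w ≠ 0) :
    0 < τ * w * (w + Real.cos w * Real.sin w) + 2 * w ^ 2 * Real.cos w ^ 2 := by
  have := mul_pos hτ (mul_add_cos_mul_sin_pos hw)
  have : 0 ≤ 2 * w ^ 2 * Real.cos w ^ 2 := by positivity
  linarith

/-- The derivative of the characteristic function at a point `iw/τ` of the imaginary axis where
`b cos w = 1`. -/
theorem deriv_characteristicFn_imag {τ b w : ℝ} (r : ℝ) (hτ : 0 < τ) (hc : Real.cos w ≠ 0)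
    (hb : b = 1 / Real.cos w) :
    Complex.exp (-(((w / τ : ℝ) : ℂ) * Complex.I * τ)) =
      Real.cos w - Real.sin w * Complex.I ∧
    deriv (characteristicFn r τ b) (((w / τ : ℝ) : ℂ) * Complex.I) =
      (w * Real.tan w : ℝ) + (2 * (w / τ) + Real.tan w + w : ℝ) * Complex.I := by
  have he : Complex.exp (-(((w / τ : ℝ) : ℂ) * Complex.I * τ)) =
      Real.cos w - Real.sin w * Complex.I := by
    have hτ' : (τ : ℂ) ≠ 0 := by exact_mod_cast hτ.ne'
    rw [show -(((w / τ : ℝ) : ℂ) * Complex.I * τ) = ((-w : ℝ) : ℂ) * Complex.I by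
      push_cast
      field_simp, Complex.exp_mul_I, ← Complex.ofReal_cos, ← Complex.ofReal_sin,
      Real.cos_neg, Real.sin_neg]
    push_cast
    ring
  refine ⟨he, ?_⟩
  rw [(hasDerivAt_characteristicFn r τ b _).deriv, he, hb, Real.tan_eq_sin_div_cos]
  have hτ' : (τ : ℂ) ≠ 0 := by exact_mod_cast hτ.ne'
  have hc' : ((Real.cos w : ℝ) : ℂ) ≠ 0 := by exact_mod_cast hc
  push_cast at hc' ⊢
  field_simp
  linear_combination (-(w : ℂ) * τ * Complex.sin w) * Complex.I_sq

theorem imagRoot_velocity {τ b w : ℝ} (r : ℝ) (hτ : 0 < τ) (hw : w ≠ 0) (hc : Real.cos w ≠ 0)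
    (hb : b = 1 / Real.cos w) {z : ℂ} (hz : z = ((w / τ : ℝ) : ℂ) * Complex.I) :
    deriv (characteristicFn r τ b) z ≠ 0 ∧
    0 < (2 * w + τ * Real.tan w + τ * w) ^ 2 + (τ * w * Real.tan w) ^ 2 ∧
    (z * Complex.exp (-(z * τ)) / deriv (characteristicFn r τ b) z).re =
      b * ((τ * w * (w + Real.cos w * Real.sin w) + 2 * w ^ 2 * Real.cos w ^ 2) /
        ((2 * w + τ * Real.tan w + τ * w) ^ 2 + (τ * w * Real.tan w) ^ 2)) := by
  obtain ⟨he, hD⟩ := deriv_characteristicFn_imag r hτ hc hb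
  have hnum : w * Real.cos w * (2 * w + τ * Real.tan w + τ * w) +
      w * Real.sin w * (τ * w * Real.tan w) =
      b * (τ * w * (w + Real.cos w * Real.sin w) + 2 * w ^ 2 * Real.cos w ^ 2) := by
    rw [hb, Real.tan_eq_sin_div_cos]
    field_simp
    linear_combination (w * τ) * Real.sin_sq_add_cos_sq w
  have hb0 : b ≠ 0 := by rw [hb]; exact one_div_ne_zero hc
  have hne := mul_ne_zero hb0 (crossing_numerator_pos hτ hw).ne'
  -- If both squares vanished, the left side of `hnum` would be zero, while its right side is `b ≠
  -- 0` times a positive number. Thus simplicity comes from the nonzero crossing speed.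
  have hQ : 0 < (2 * w + τ * Real.tan w + τ * w) ^ 2 + (τ * w * Real.tan w) ^ 2 := by
    refine lt_of_le_of_ne (by positivity) fun h => hne ?_
    have h1 : 2 * w + τ * Real.tan w + τ * w = 0 := by nlinarith
    have h2 : τ * w * Real.tan w = 0 := by nlinarith
    rw [← hnum, h1, h2]
    ring
  have hre : (deriv (characteristicFn r τ b) z).re = w * Real.tan w := by
    rw [hz, hD]; simp [-Complex.ofReal_mul, -Complex.ofReal_add]
  have him : (deriv (characteristicFn r τ b) z).im = 2 * (w / τ) + Real.tan w + w := by
    rw [hz, hD]; simp [-Complex.ofReal_mul, -Complex.ofReal_add]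
  have hsq : Complex.normSq (deriv (characteristicFn r τ b) z) =
      ((2 * w + τ * Real.tan w + τ * w) ^ 2 + (τ * w * Real.tan w) ^ 2) / τ ^ 2 := by
    rw [Complex.normSq_apply, hre, him]
    field_simp
    ring
  refine ⟨?_, hQ, ?_⟩
  · intro h
    rw [h, map_zero] at hsq
    exact (div_pos hQ (by positivity)).ne hsq
  · have hn : z * Complex.exp (-(z * τ)) =
        (w / τ * Real.sin w : ℝ) + (w / τ * Real.cos w : ℝ) * Complex.I := by
      rw [hz, he]
      push_cast
      linear_combination (-(w / τ : ℂ) * Complex.sin w) * Complex.I_sq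
    rw [Complex.div_re, hsq, hre, him, hn, ← mul_div_assoc b, ← hnum]
    simp only [Complex.add_re, Complex.ofReal_re, Complex.mul_re, Complex.I_re, mul_zero,
      Complex.ofReal_im, Complex.I_im, mul_one, sub_self, add_zero, Complex.add_im, Complex.mul_im,
      zero_add]
    have := hQ.ne'
    field_simp
    ring

/-- Since `exp(-is) / cos s = 1 - i tan s`, the denominator splits into real and imaginary parts. -/
theorem crossingSpeed_eq {r s : ℝ} (hc : Real.cos s ≠ 0) :
    crossingSpeed r s =
      bC s * ((tauC r s * s * (s + Real.cos s * Real.sin s) + 2 * s ^ 2 * Real.cos s ^ 2) /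
        ((2 * s + tauC r s * Real.tan s + tauC r s * s) ^ 2 +
          (tauC r s * s * Real.tan s) ^ 2)) := by
  have hc' : ((Real.cos s : ℝ) : ℂ) ≠ 0 := by exact_mod_cast hc
  have h : (2 * s + tauC r s * Real.tan s : ℂ) +
      tauC r s * s * ((Real.cos s : ℝ) : ℂ)⁻¹ * Complex.exp (-(Complex.I * s)) =
      (2 * s + tauC r s * Real.tan s + tauC r s * s : ℝ) +
        (-(tauC r s * s * Real.tan s) : ℝ) * Complex.I := by
    rw [show -(Complex.I * s) = ((-s : ℝ) : ℂ) * Complex.I by push_cast; ring,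
      Complex.exp_mul_I, ← Complex.ofReal_cos, ← Complex.ofReal_sin, Real.cos_neg, Real.sin_neg,
      Real.tan_eq_sin_div_cos]
    push_cast at hc' ⊢
    field_simp
    ring
  unfold crossingSpeed
  rw [h, Complex.sq_norm, Complex.normSq_add_mul_I, neg_sq]

theorem curve_root_crossing {r : ℝ} (hr : 0 < r) {n : ℕ} {s : ℝ} (hs : s ∈ curveInterval n) {z : ℂ}
    (hz : z = ((s / tauC r s : ℝ) : ℂ) * Complex.I ∨
      z = -(((s / tauC r s : ℝ) : ℂ) * Complex.I)) :
    IsSimpleRoot r (tauC r s) (bC s) z ∧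
      ∃ l : ℝ → ℂ, IsRootBranch r (tauC r s) (bC s) z l ∧
        (deriv l (bC s)).re = crossingSpeed r s ∧
        (deriv l (bC s)).re ≠ 0 ∧
        SignType.sign (deriv l (bC s)).re = SignType.sign (bC s) := by
  have hs0 := pos_of_mem_curveInterval hs
  have hτ := tauC_pos hr hs0
  have hc := cos_ne_zero_of_mem hs
  have hroot : z ∈ imagRoots r (tauC r s) (bC s) :=
    (mem_imagRoots_iff hr hτ).2 ⟨n, s, hs, rfl, rfl, hz⟩
  have hz0 : z ≠ 0 := by
    rintro rfl
    exact characteristicFn_zero_ne hr _ _ hroot.1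
  have key : deriv (characteristicFn r (tauC r s) (bC s)) z ≠ 0 ∧
      0 < (2 * s + tauC r s * Real.tan s + tauC r s * s) ^ 2 + (tauC r s * s * Real.tan s) ^ 2 ∧
      (z * Complex.exp (-(z * tauC r s)) /
        deriv (characteristicFn r (tauC r s) (bC s)) z).re = crossingSpeed r s := by
    rw [crossingSpeed_eq hc]
    rcases hz with hz | hz
    · exact imagRoot_velocity r hτ hs0.ne' hc rfl hz
    -- The conjugate root has parameter `-s`, and the velocity formula is even in the parameter.
    · have := imagRoot_velocity (w := -s) (b := bC s) r hτ (neg_ne_zero.2 hs0.ne')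
        (by rwa [Real.cos_neg]) (by rw [Real.cos_neg, bC])
        (z := z) (by rw [hz]; push_cast; ring)
      rw [Real.cos_neg, Real.sin_neg, Real.tan_neg] at this
      have e1 : (2 * -s + tauC r s * -Real.tan s + tauC r s * -s) ^ 2 +
          (tauC r s * -s * -Real.tan s) ^ 2 =
          (2 * s + tauC r s * Real.tan s + tauC r s * s) ^ 2 +
            (tauC r s * s * Real.tan s) ^ 2 := by ring
      have e2 : tauC r s * -s * (-s + Real.cos s * -Real.sin s) + 2 * (-s) ^ 2 * Real.cos s ^ 2 =
          tauC r s * s * (s + Real.cos s * Real.sin s) + 2 * s ^ 2 * Real.cos s ^ 2 := by ring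
      rwa [e1, e2] at this
  obtain ⟨hD, hQ, hv⟩ := key
  obtain ⟨l, hl, hld⟩ := exists_rootBranch hz0 ⟨hroot.1, hD⟩
  refine ⟨⟨hroot.1, hD⟩, l, hl, ?_⟩
  rw [hld.deriv, hv]
  have hpos := div_pos (crossing_numerator_pos hτ hs0.ne') hQ
  have hb : bC s ≠ 0 := one_div_ne_zero hc
  rw [crossingSpeed_eq hc]
  exact ⟨rfl, mul_ne_zero hb hpos.ne', by rw [sign_mul, sign_pos hpos, mul_one]⟩

/-! ### Monotonicity and intersections of the curves -/

theorem tan_lt_tan_of_mem {n : ℕ} {s t : ℝ} (hs : s ∈ curveInterval n) (ht : t ∈ curveInterval n)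
    (h : s < t) : Real.tan s < Real.tan t := by
  rw [← Real.tan_sub_nat_mul_pi s n, ← Real.tan_sub_nat_mul_pi t n]
  exact Real.strictMonoOn_tan (mem_curveInterval_iff.1 hs).2 (mem_curveInterval_iff.1 ht).2
    (by linarith)

theorem add_sqrt_lt {r x y : ℝ} (hr : 0 < r) (h : x < y) :
    x + √(x ^ 2 + 4 * r) < y + √(y ^ 2 + 4 * r) := by
  have hq : 0 < √(y ^ 2 + 4 * r) := by positivity
  have hp := add_sqrt_pos hr y
  have h1 : √(x ^ 2 + 4 * r) < y - x + √(y ^ 2 + 4 * r) := by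
    rw [Real.sqrt_lt' (by linarith)]
    have := Real.sq_sqrt (show 0 ≤ y ^ 2 + 4 * r by positivity)
    -- After squaring, the two sides differ by `2 (y - x) (y + √(y² + 4r))`.
    nlinarith [mul_pos (sub_pos.2 h) hp]
  linarith

theorem tauC_strictMonoOn {r : ℝ} (hr : 0 < r) (n : ℕ) : StrictMonoOn (tauC r) (curveInterval n) := by
  intro s hs t ht h
  unfold tauC
  have hs0 := pos_of_mem_curveInterval hs
  exact mul_lt_mul'' (div_lt_div_of_pos_right h (by positivity))
    (add_sqrt_lt hr (tan_lt_tan_of_mem hs ht h)) (by positivity) (add_sqrt_pos hr _).le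

/-- The value of `tan s` prescribed by the delay `τ`. -/
noncomputable def tanValue (r τ s : ℝ) : ℝ := r * τ / s - s / τ

theorem tanValue_lt {r τ s t : ℝ} (hr : 0 < r) (hτ : 0 < τ) (hs : 0 < s) (h : s < t) :
    tanValue r τ t < tanValue r τ s := by
  unfold tanValue
  have h1 : r * τ / t < r * τ / s := div_lt_div_of_pos_left (by positivity) hs h
  have h2 : s / τ < t / τ := div_lt_div_of_pos_right h hτ
  linarith

theorem tanValue_inj {r τ s t : ℝ} (hr : 0 < r) (hτ : 0 < τ) (hs : 0 < s) (ht : 0 < t)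
    (h : tanValue r τ s = tanValue r τ t) : s = t := by
  rcases lt_trichotomy s t with h1 | h1 | h1
  · exact absurd h (tanValue_lt hr hτ hs h1).ne'
  · exact h1
  · exact absurd h (tanValue_lt hr hτ ht h1).ne

theorem bC_sq_of_tauC {r τ s : ℝ} {n : ℕ} (hr : 0 < r) (hτ : 0 < τ) (hs : s ∈ curveInterval n)
    (h : τ = tauC r s) : bC s ^ 2 = 1 + tanValue r τ s ^ 2 := by
  rw [tanValue, ← (eq_tauC_iff hr hτ (pos_of_mem_curveInterval hs)).1 h, bC, div_pow, one_pow]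
  have := Real.inv_one_add_tan_sq (cos_ne_zero_of_mem hs)
  rw [one_div, ← this, inv_inv]

/-- Equal slopes give equal squares of `tanValue`; equal values are excluded by injectivity. -/
theorem tanValue_neg_of_meet {r τ b s t : ℝ} {n m : ℕ} (hr : 0 < r) (hτ : 0 < τ)
    (hs : s ∈ curveInterval n) (ht : t ∈ curveInterval m) (hst : s ≠ t)
    (h1 : τ = tauC r s) (h2 : τ = tauC r t) (h3 : b = bC s) (h4 : b = bC t) :
    tanValue r τ s = -tanValue r τ t := by
  have e1 := bC_sq_of_tauC hr hτ hs h1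
  have e2 := bC_sq_of_tauC hr hτ ht h2
  rw [← h3] at e1
  rw [← h4] at e2
  have : tanValue r τ s ^ 2 = tanValue r τ t ^ 2 := by linarith
  rcases sq_eq_sq_iff_eq_or_eq_neg.1 this with h | h
  · exact absurd (tanValue_inj hr hτ (pos_of_mem_curveInterval hs)
      (pos_of_mem_curveInterval ht) h) hst
  · exact h

theorem curve_parameter_unique {r s t : ℝ} {n : ℕ} (hr : 0 < r)
    (hs : s ∈ curveInterval n) (ht : t ∈ curveInterval n) (h : tauC r s = tauC r t) : s = t :=
  (tauC_strictMonoOn hr n).injOn hs ht h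

/-- The parameters on `m` and `k` both have the `tanValue` opposite to that on `n`, so they
coincide. -/
theorem not_three_curves {r τ b : ℝ} (hr : 0 < r) (hτ : 0 < τ) {n m k : ℕ} (hnm : n ≠ m)
    (hnk : n ≠ k) (hn : OnCurve r n τ b) (hm : OnCurve r m τ b) (hk : OnCurve r k τ b) :
    m = k := by
  obtain ⟨s, hs, s1, s2⟩ := hn
  obtain ⟨t, ht, t1, t2⟩ := hm
  obtain ⟨u, hu, u1, u2⟩ := hk
  have hst : s ≠ t := fun h => hnm (curveInterval_index_unique hs (h ▸ ht))
  have hsu : s ≠ u := fun h => hnk (curveInterval_index_unique hs (h ▸ hu))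
  have e1 := tanValue_neg_of_meet hr hτ hs ht hst s1 t1 s2 t2
  have e2 := tanValue_neg_of_meet hr hτ hs hu hsu s1 u1 s2 u2
  have e3 := tanValue_inj hr hτ (pos_of_mem_curveInterval ht) (pos_of_mem_curveInterval hu)
    (show tanValue r τ t = tanValue r τ u by linarith)
  exact curveInterval_index_unique ht (e3 ▸ hu)

/-- The product with `b` expresses motion to the right as `|b|` grows, for both signs of `b` at
once. -/
theorem imagRoots_transversal {r τ b : ℝ} (hr : 0 < r) (hτ : 0 < τ) {z : ℂ}
    (hz : z ∈ imagRoots r τ b) :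
    IsSimpleRoot r τ b z ∧ ∃ l : ℝ → ℂ, IsRootBranch r τ b z l ∧ 0 < b * (deriv l b).re := by
  obtain ⟨n, s, hs, rfl, rfl, h⟩ := (mem_imagRoots_iff hr hτ).1 hz
  obtain ⟨h1, l, h2, -, h3, h4⟩ := curve_root_crossing hr hs h
  refine ⟨h1, l, h2, ?_⟩
  have hb : bC s ≠ 0 := one_div_ne_zero (cos_ne_zero_of_mem hs)
  rw [← sign_eq_one_iff, sign_mul, h4, ← sign_mul, sign_eq_one_iff]
  exact mul_self_pos.2 hb

theorem imagRoots_simple_crossing {r τ b : ℝ} (hr : 0 < r) (hτ : 0 < τ) {z : ℂ}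
    (hz : z ∈ imagRoots r τ b) : IsSimpleRoot r τ b z ∧ CrossesTransversally r τ b z := by
  obtain ⟨h1, l, h2, h3⟩ := imagRoots_transversal hr hτ hz
  exact ⟨h1, hz.2, l, h2, fun h => by simp [h] at h3⟩

/-! ### Hopf and double-Hopf points -/

theorem ofReal_mul_I_inj {x y : ℝ} : (x : ℂ) * Complex.I = y * Complex.I ↔ x = y := by
  rw [mul_left_inj' Complex.I_ne_zero, Complex.ofReal_inj]

theorem ofReal_mul_I_ne_neg {x y : ℝ} (hx : 0 < x) (hy : 0 < y) :
    (x : ℂ) * Complex.I ≠ -(y * Complex.I) := by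
  intro h
  have := congrArg Complex.im h
  simp at this
  linarith

theorem frequency_mem_imagRoots {r τ b s : ℝ} {n : ℕ} (hr : 0 < r) (hτ : 0 < τ)
    (hs : s ∈ curveInterval n) (h1 : τ = tauC r s) (h2 : b = bC s) :
    ((s / τ : ℝ) : ℂ) * Complex.I ∈ imagRoots r τ b :=
  (mem_imagRoots_iff hr hτ).2 ⟨n, s, hs, h1, h2, Or.inl rfl⟩

theorem exists_curve_of_frequency {r τ b Ω : ℝ} (hr : 0 < r) (hτ : 0 < τ) (hΩ : 0 < Ω)
    (h : (Ω : ℂ) * Complex.I ∈ imagRoots r τ b) :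
    ∃ n, Ω * τ ∈ curveInterval n ∧ τ = tauC r (Ω * τ) ∧ b = bC (Ω * τ) :=
  (characteristicFn_pos_iff hr hτ hΩ).1 h.1

theorem imagRoots_eq_pair {r τ b s : ℝ} {n : ℕ} (hr : 0 < r) (hτ : 0 < τ)
    (hs : s ∈ curveInterval n) (h1 : τ = tauC r s) (h2 : b = bC s)
    (huniq : ∀ m, OnCurve r m τ b → m = n) :
    imagRoots r τ b = {((s / τ : ℝ) : ℂ) * Complex.I, -(((s / τ : ℝ) : ℂ) * Complex.I)} := by
  ext z
  rw [mem_imagRoots_iff hr hτ, mem_insert_iff, mem_singleton_iff]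
  constructor
  · rintro ⟨m, t, ht, t1, t2, h⟩
    obtain rfl := huniq m ⟨t, ht, t1, t2⟩
    rwa [curve_parameter_unique hr hs ht (h1.symm.trans t1)]
  · intro h
    exact ⟨n, s, hs, h1, h2, h⟩

theorem imagRoots_eq_two_pairs {r τ b s t : ℝ} {n m : ℕ} (hr : 0 < r) (hτ : 0 < τ)
    (hnm : n ≠ m) (hs : s ∈ curveInterval n) (h1 : τ = tauC r s) (h2 : b = bC s)
    (ht : t ∈ curveInterval m) (h3 : τ = tauC r t) (h4 : b = bC t) :
    imagRoots r τ b = {((s / τ : ℝ) : ℂ) * Complex.I, -(((s / τ : ℝ) : ℂ) * Complex.I),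
      ((t / τ : ℝ) : ℂ) * Complex.I, -(((t / τ : ℝ) : ℂ) * Complex.I)} := by
  ext z
  simp only [mem_imagRoots_iff hr hτ, mem_insert_iff, mem_singleton_iff]
  constructor
  · rintro ⟨k, u, hu, u1, u2, h⟩
    by_cases hk : n = k
    · subst hk
      rw [curve_parameter_unique hr hs hu (h1.symm.trans u1)]
      tauto
    · obtain rfl := not_three_curves hr hτ hnm hk ⟨s, hs, h1, h2⟩ ⟨t, ht, h3, h4⟩ ⟨u, hu, u1, u2⟩
      rw [curve_parameter_unique hr ht hu (h3.symm.trans u1)]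
      tauto
  · rintro (h | h | h | h)
    · exact ⟨n, s, hs, h1, h2, Or.inl h⟩
    · exact ⟨n, s, hs, h1, h2, Or.inr h⟩
    · exact ⟨m, t, ht, h3, h4, Or.inl h⟩
    · exact ⟨m, t, ht, h3, h4, Or.inr h⟩

/-- Simplicity and transversality hold at every imaginary root, so only the number of pairs matters;
frequencies and curve parameters correspond by `s = Ωτ`. -/
theorem isHopfPoint_iff {r τ : ℝ} (hr : 0 < r) (hτ : 0 < τ) (b : ℝ) :
    IsHopfPoint r τ b ↔ ∃! n : ℕ, OnCurve r n τ b := by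
  constructor
  · rintro ⟨Ω, hΩ, himag, -⟩
    obtain ⟨n, hn, h1, h2⟩ := exists_curve_of_frequency hr hτ hΩ (by rw [himag]; simp)
    refine ⟨n, ⟨_, hn, h1, h2⟩, ?_⟩
    rintro m ⟨t, ht, t1, t2⟩
    have h := frequency_mem_imagRoots hr hτ ht t1 t2
    have ht0 : 0 < t / τ := div_pos (pos_of_mem_curveInterval ht) hτ
    rw [himag, mem_insert_iff, mem_singleton_iff, ofReal_mul_I_inj] at h
    have h' := h.resolve_right (ofReal_mul_I_ne_neg ht0 hΩ)
    rw [← h', div_mul_cancel₀ _ hτ.ne'] at hn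
    exact curveInterval_index_unique ht hn
  · rintro ⟨n, ⟨s, hs, h1, h2⟩, huniq⟩
    exact ⟨s / τ, div_pos (pos_of_mem_curveInterval hs) hτ,
      imagRoots_eq_pair hr hτ hs h1 h2 huniq, fun z hz => imagRoots_simple_crossing hr hτ hz⟩

theorem isDoubleHopfPoint_iff {r τ : ℝ} (hr : 0 < r) (hτ : 0 < τ) (b : ℝ) :
    IsDoubleHopfPoint r τ b ↔ ∃ n m : ℕ, n ≠ m ∧ OnCurve r n τ b ∧ OnCurve r m τ b := by
  constructor
  · rintro ⟨Ω₁, Ω₂, h0, hlt, himag, -⟩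
    obtain ⟨n, hn, h1, h2⟩ := exists_curve_of_frequency hr hτ h0 (by rw [himag]; simp)
    obtain ⟨m, hm, h3, h4⟩ := exists_curve_of_frequency hr hτ (h0.trans hlt)
      (by rw [himag]; simp)
    refine ⟨n, m, ?_, ⟨_, hn, h1, h2⟩, ⟨_, hm, h3, h4⟩⟩
    rintro rfl
    have := curve_parameter_unique hr hn hm (h1.symm.trans h3)
    exact hlt.ne (mul_right_cancel₀ hτ.ne' this)
  · rintro ⟨n, m, hnm, ⟨s, hs, h1, h2⟩, ⟨t, ht, h3, h4⟩⟩
    have hs0 : 0 < s / τ := div_pos (pos_of_mem_curveInterval hs) hτ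
    have ht0 : 0 < t / τ := div_pos (pos_of_mem_curveInterval ht) hτ
    rcases lt_trichotomy s t with h | h | h
    · exact ⟨s / τ, t / τ, hs0, div_lt_div_of_pos_right h hτ,
        imagRoots_eq_two_pairs hr hτ hnm hs h1 h2 ht h3 h4,
        fun z hz => imagRoots_simple_crossing hr hτ hz⟩
    · exact absurd (curveInterval_index_unique hs (h ▸ ht)) hnm
    · exact ⟨t / τ, s / τ, ht0, div_lt_div_of_pos_right h hτ,
        imagRoots_eq_two_pairs hr hτ hnm.symm ht h3 h4 hs h1 h2,
        fun z hz => imagRoots_simple_crossing hr hτ hz⟩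

theorem IsHopfPoint.ncard_imagRoots {r τ b : ℝ} (h : IsHopfPoint r τ b) :
    (imagRoots r τ b).ncard = 2 := by
  obtain ⟨Ω, h0, himag, -⟩ := h
  rw [himag, ncard_pair (ofReal_mul_I_ne_neg h0 h0)]

theorem IsDoubleHopfPoint.ncard_imagRoots {r τ b : ℝ} (h : IsDoubleHopfPoint r τ b) :
    (imagRoots r τ b).ncard = 4 := by
  obtain ⟨Ω₁, Ω₂, h0, hlt, himag, -⟩ := h
  have h0' := h0.trans hlt
  have a1 := ofReal_mul_I_ne_neg h0 h0
  have a2 := ofReal_mul_I_ne_neg h0 h0'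
  have a3 := ofReal_mul_I_ne_neg h0' h0
  have a4 := ofReal_mul_I_ne_neg h0' h0'
  have a5 : (Ω₁ : ℂ) * Complex.I ≠ Ω₂ * Complex.I := fun h => hlt.ne (ofReal_mul_I_inj.1 h)
  rw [himag, ncard_insert_of_notMem, ncard_insert_of_notMem, ncard_pair a4]
  · simp only [mem_insert_iff, mem_singleton_iff, neg_inj]
    exact fun h => h.elim (fun h => a3 h.symm) a5
  · simp only [mem_insert_iff, mem_singleton_iff]
    rintro (h | h | h)
    · exact a1 h
    · exact a5 h
    · exact a2 h

theorem isHopfPoint_or_isDoubleHopfPoint {r τ b : ℝ} (hr : 0 < r) (hτ : 0 < τ)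
    (h : ∃ n, OnCurve r n τ b) : IsHopfPoint r τ b ∨ IsDoubleHopfPoint r τ b := by
  rw [isHopfPoint_iff hr hτ, isDoubleHopfPoint_iff hr hτ]
  obtain ⟨n, hn⟩ := h
  by_cases h' : ∃ m, n ≠ m ∧ OnCurve r m τ b
  · obtain ⟨m, hnm, hm⟩ := h'
    exact Or.inr ⟨n, m, hnm, hn, hm⟩
  · push Not at h'
    exact Or.inl ⟨n, hn, fun m hm => by_contra fun hne => h' m (Ne.symm hne) hm⟩

theorem imagRoots_finite {r τ b : ℝ} (hr : 0 < r) (hτ : 0 < τ) : (imagRoots r τ b).Finite := by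
  rcases (imagRoots r τ b).eq_empty_or_nonempty with h | ⟨z, hz⟩
  · rw [h]
    exact finite_empty
  · rcases isHopfPoint_or_isDoubleHopfPoint hr hτ ((exists_imagRoot_iff hr hτ b).1 ⟨z, hz⟩) with
      h | h
    · exact finite_of_ncard_ne_zero (by rw [h.ncard_imagRoots]; norm_num)
    · exact finite_of_ncard_ne_zero (by rw [h.ncard_imagRoots]; norm_num)

/-! ### Roots in the right half-plane as the slope varies -/

theorem continuous_characteristicFn (r τ : ℝ) :
    Continuous fun p : ℝ × ℂ => characteristicFn r τ p.1 p.2 := by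
  unfold characteristicFn
  fun_prop

/-- For `Re z ≥ 0` the exponential has modulus at most `1`, whence `‖z‖² ≤ (|b| + 1) ‖z‖ + r`. The
bound confines these roots to a compact set. -/
theorem norm_le_of_root {r τ b : ℝ} (hr : 0 < r) (hτ : 0 < τ) {z : ℂ} (hz : 0 ≤ z.re)
    (h : characteristicFn r τ b z = 0) : ‖z‖ ≤ |b| + 1 + r := by
  have he : ‖Complex.exp (-(z * τ))‖ ≤ 1 := by
    rw [Complex.norm_exp, Real.exp_le_one_iff]
    simpa using mul_nonneg hz hτ.le
  have h1 : z ^ 2 = b * z * Complex.exp (-(z * τ)) - z - r := by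
    unfold characteristicFn at h
    linear_combination h
  have h2 : ‖z‖ ^ 2 ≤ |b| * ‖z‖ + ‖z‖ + r := by
    rw [← norm_pow, h1]
    refine (norm_sub_le _ _).trans (add_le_add ((norm_sub_le _ _).trans
      (add_le_add ?_ le_rfl)) ?_)
    · rw [norm_mul, norm_mul, Complex.norm_real, Real.norm_eq_abs]
      exact mul_le_of_le_one_right (by positivity) he
    · rw [Complex.norm_real, Real.norm_eq_abs, abs_of_pos hr]
  by_contra! hlt
  have hb := abs_nonneg b
  nlinarith

/-- If no root of the closed right half-plane lies outside the open set `U` at the slope `b`, the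
same holds at all nearby slopes. -/
theorem eventually_roots_mem {r τ b : ℝ} (hr : 0 < r) (hτ : 0 < τ) {U : Set ℂ} (hU : IsOpen U)
    (h : ∀ z : ℂ, characteristicFn r τ b z = 0 → 0 ≤ z.re → z ∈ U) :
    ∀ᶠ b' in 𝓝 b, ∀ z : ℂ, characteristicFn r τ b' z = 0 → 0 ≤ z.re → z ∈ U := by
  -- The radius is the root bound for slopes with `|b'| < |b| + 1`, so `K` contains every root with
  -- `Re z ≥ 0` that escapes `U`.
  let K : Set ℂ := (Metric.closedBall 0 (|b| + 1 + 1 + r) ∩ {z | 0 ≤ z.re}) \ U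
  have hK : IsCompact K :=
    ((isCompact_closedBall _ _).inter_right
      (isClosed_le continuous_const Complex.continuous_re)).diff hU
  have h1 : ∀ᶠ b' in 𝓝 b, ∀ z ∈ K, characteristicFn r τ b' z ≠ 0 := by
    refine hK.eventually_forall_of_forall_eventually fun z hz => ?_
    exact (continuous_characteristicFn r τ).continuousAt.eventually_ne
      fun h0 => hz.2 (h z h0 hz.1.2)
  have h2 : ∀ᶠ b' in 𝓝 b, |b'| < |b| + 1 :=
    continuous_abs.continuousAt.eventually (gt_mem_nhds (lt_add_one |b|))
  filter_upwards [h1, h2] with b' h1 h2 z hz hre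
  by_contra hzU
  refine h1 z ⟨⟨?_, hre⟩, hzU⟩ hz
  rw [mem_closedBall_zero_iff]
  linarith [norm_le_of_root hr hτ hre hz]

theorem isOpen_setOf_no_root {r τ : ℝ} (hr : 0 < r) (hτ : 0 < τ) :
    IsOpen {b : ℝ | ∀ z : ℂ, characteristicFn r τ b z = 0 → z.re < 0} := by
  rw [isOpen_iff_eventually]
  intro b hb
  have := eventually_roots_mem hr hτ isOpen_empty (b := b)
    fun z hz hre => absurd (hb z hz) hre.not_gt
  filter_upwards [this] with b' h z hz
  by_contra! hre
  exact h z hz hre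

/-- The unstable slopes are the real points in the image of the open right half-plane under
`slopeFn`, open by the open mapping theorem. -/
theorem isOpen_setOf_unstable {r τ : ℝ} (hr : 0 < r) (hτ : 0 < τ) :
    IsOpen {b : ℝ | ∃ z : ℂ, characteristicFn r τ b z = 0 ∧ 0 < z.re} := by
  let U : Set ℂ := {z | 0 < z.re}
  have hU : IsOpen U := isOpen_lt continuous_const Complex.continuous_re
  have hne {z : ℂ} (hz : z ∈ U) : z ≠ 0 := by
    rintro rfl
    simp [U] at hz
  have hana : AnalyticOnNhd ℂ (slopeFn r τ) U := by
    refine DifferentiableOn.analyticOnNhd (fun z hz => ?_) hU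
    exact (hasDerivAt_slopeFn r τ (hne hz)).differentiableAt.differentiableWithinAt
  have hconv : IsPreconnected U := (convex_halfSpace_re_gt 0).isPreconnected
  have hreal {x : ℝ} (hx : 0 < x) :
      slopeFn r τ x = (((x ^ 2 + x + r) * Real.exp (x * τ) / x : ℝ) : ℂ) := by
    unfold slopeFn
    push_cast
    rfl
  have himg : IsOpen (slopeFn r τ '' U) := by
    rcases hana.is_constant_or_isOpen hconv with ⟨w, hw⟩ | h
    · exfalso
      have h1 : slopeFn r τ (1 : ℝ) = w := hw _ (by simp [U])
      -- A constant `slopeFn` would take its value `x` at `x` too, but `(x² + x + r) exp(xτ) > x²`.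
      set x := (1 ^ 2 + 1 + r) * Real.exp (1 * τ) / 1 with hx
      have hx0 : 0 < x := by positivity
      have h2 : slopeFn r τ (x : ℝ) = w := hw _ (by simpa [U] using hx0)
      rw [hreal one_pos, ← hx] at h1
      rw [hreal hx0, ← h1, Complex.ofReal_inj, div_eq_iff hx0.ne'] at h2
      have h3 : 1 ≤ Real.exp (x * τ) := Real.one_le_exp (by positivity)
      have h4 : (x ^ 2 + x + r) * 1 ≤ (x ^ 2 + x + r) * Real.exp (x * τ) :=
        mul_le_mul_of_nonneg_left h3 (by positivity)
      nlinarith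
    · exact h U subset_rfl hU
  convert himg.preimage Complex.continuous_ofReal using 1
  ext b
  constructor
  · rintro ⟨z, h1, h2⟩
    exact ⟨z, h2, (characteristicFn_eq_zero_iff_slopeFn (hne h2)).1 h1⟩
  · rintro ⟨z, h2, h1⟩
    exact ⟨z, (characteristicFn_eq_zero_iff_slopeFn (hne h2)).2 h1, h2⟩

theorem re_neg_of_root_zero_slope {r τ : ℝ} (hr : 0 < r) {z : ℂ}
    (h : characteristicFn r τ 0 z = 0) : z.re < 0 := by
  by_contra! hre
  have h1 := congrArg Complex.re h
  have h2 := congrArg Complex.im h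
  simp [characteristicFn, pow_two] at h1 h2
  have h3 : z.im * (2 * z.re + 1) = 0 := by linarith
  have h4 : z.im = 0 := (mul_eq_zero.1 h3).resolve_right (by positivity)
  rw [h4] at h1
  nlinarith [mul_nonneg hre hre]

/-- Continuation of stability from the slope `0` along a segment without imaginary roots. -/
theorem stable_of_forall_not_onCurve {r τ : ℝ} (hr : 0 < r) (hτ : 0 < τ) {S : Set ℝ}
    (hS : IsPreconnected S) (h0 : (0 : ℝ) ∈ S) (h : ∀ b ∈ S, ∀ n, ¬ OnCurve r n τ b) :
    ∀ b ∈ S, ∀ z : ℂ, characteristicFn r τ b z = 0 → z.re < 0 := by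
  -- Without imaginary roots, the disjoint open sets of unstable and of stable slopes cover `S`, and
  -- `0` is stable.
  have := hS.subset_right_of_subset_union (isOpen_setOf_unstable hr hτ)
    (isOpen_setOf_no_root hr hτ) ?_ ?_ ⟨0, h0, fun z hz => re_neg_of_root_zero_slope hr hz⟩
  · exact this
  · rw [Set.disjoint_left]
    rintro b ⟨z, hz, hre⟩ hb
    exact (hb z hz).not_gt hre
  · intro b hb
    by_cases hu : ∃ z : ℂ, characteristicFn r τ b z = 0 ∧ 0 < z.re
    · exact Or.inl hu
    · right
      intro z hz
      by_contra! hre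
      rcases hre.eq_or_lt with h1 | h1
      · obtain ⟨n, hn⟩ := (exists_imagRoot_iff hr hτ b).1 ⟨z, hz, h1.symm⟩
        exact h b hb n hn
      · exact hu ⟨z, hz, h1⟩

theorem unstableRoots_eq_empty_of_frequently_stable {r τ b : ℝ} (hr : 0 < r) (hτ : 0 < τ)
    (h : ∃ᶠ b' in 𝓝 b, ∀ z : ℂ, characteristicFn r τ b' z = 0 → z.re < 0) :
    unstableRoots r τ b = ∅ := by
  rw [Set.eq_empty_iff_forall_notMem]
  rintro z ⟨hz, hre⟩
  obtain ⟨b', h1, w, h2, h3⟩ :=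
    (h.and_eventually ((isOpen_setOf_unstable hr hτ).mem_nhds ⟨z, hz, hre⟩)).exists
  exact (h1 w h2).not_gt h3

/-- When the slope moves away from `b`, where there are no unstable roots, in the direction of
increasing modulus, exactly the imaginary roots become unstable. -/
theorem eventually_ncard_unstableRoots {r τ b : ℝ} (hr : 0 < r) (hτ : 0 < τ)
    (hst : unstableRoots r τ b = ∅) :
    ∀ᶠ b' in 𝓝 b, 0 < b * (b' - b) →
      (unstableRoots r τ b').ncard = (imagRoots r τ b).ncard := by
  have hfin := imagRoots_finite (b := b) hr hτ
  -- A dummy branch off the imaginary roots makes `l` and `U` total functions after `choose`.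
  have hbr : ∀ z : ℂ, ∃ l : ℝ → ℂ, ∃ U : Set ℂ, z ∈ imagRoots r τ b → IsOpen U ∧ z ∈ U ∧
      Tendsto l (𝓝 b) (𝓝 z) ∧
      (∀ᶠ b' in 𝓝 b, ∀ w ∈ U, characteristicFn r τ b' w = 0 ↔ w = l b') ∧
      ∀ᶠ b' in 𝓝 b, 0 < b * (b' - b) → 0 < (l b').re := by
    intro z
    by_cases hz : z ∈ imagRoots r τ b
    · obtain ⟨-, l, ⟨hl, hlb, hev⟩, hpos⟩ := imagRoots_transversal hr hτ hz
      rw [nhds_prod_eq, eventually_prod_iff] at hev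
      obtain ⟨pa, ha, pb, hb, hab⟩ := hev
      obtain ⟨U, hUsub, hUo, hzU⟩ := mem_nhds_iff.1 hb
      refine ⟨l, U, fun _ => ⟨hUo, hzU, hlb ▸ hl.continuousAt, ?_, ?_⟩⟩
      · filter_upwards [ha] with b' h1 w hw
        exact hab h1 (hUsub hw)
      · have hd : HasDerivAt l (deriv l b) b :=
          (hl.differentiableAt (by simp)).hasDerivAt
        have hd' : HasDerivAt (fun x => (l x).re) (deriv l b).re b :=
          Complex.reCLM.hasFDerivAt.comp_hasDerivAt b hd
        have hslope := hasDerivAt_iff_tendsto_slope.1 hd'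
        have h2 : ∀ᶠ x in 𝓝[≠] b, 0 < b * slope (fun x => (l x).re) b x :=
          (hslope.const_mul b).eventually (lt_mem_nhds hpos)
        rw [eventually_nhdsWithin_iff] at h2
        filter_upwards [h2] with x hx hxb
        have hne : x - b ≠ 0 := by
          intro h0
          simp [h0] at hxb
        have hx' := hx (sub_ne_zero.1 hne)
        rw [slope_def_field, hlb, hz.2, sub_zero] at hx'
        -- Multiplying the difference quotient by the positive `b (x - b)` leaves `b²` times the
        -- real part, whatever the sign of `b`.
        have h3 : 0 < b * ((l x).re / (x - b)) * (b * (x - b)) := mul_pos hx' hxb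
        have h4 : b * ((l x).re / (x - b)) * (b * (x - b)) = b ^ 2 * (l x).re := by
          field_simp
        rw [h4] at h3
        exact pos_of_mul_pos_right h3 (sq_nonneg b)
    · exact ⟨fun _ => 0, ∅, fun h => absurd h hz⟩
  choose l U hlU using hbr
  have e1 : ∀ᶠ b' in 𝓝 b, ∀ z ∈ imagRoots r τ b, ∀ w ∈ U z,
      characteristicFn r τ b' w = 0 ↔ w = l z b' :=
    (hfin.eventually_all).2 fun z hz => (hlU z hz).2.2.2.1
  have e2 : ∀ᶠ b' in 𝓝 b, ∀ z ∈ imagRoots r τ b, 0 < b * (b' - b) → 0 < (l z b').re :=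
    (hfin.eventually_all).2 fun z hz => (hlU z hz).2.2.2.2
  have e3 : ∀ᶠ b' in 𝓝 b, ∀ z ∈ imagRoots r τ b, l z b' ∈ U z :=
    (hfin.eventually_all).2 fun z hz =>
      (hlU z hz).2.2.1.eventually ((hlU z hz).1.mem_nhds (hlU z hz).2.1)
  have e4 : ∀ᶠ b' in 𝓝 b, ∀ z ∈ imagRoots r τ b, ∀ w ∈ imagRoots r τ b,
      z ≠ w → l z b' ≠ l w b' := by
    refine (hfin.eventually_all).2 fun z hz => (hfin.eventually_all).2 fun w hw => ?_
    by_cases hzw : z = w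
    · exact Eventually.of_forall fun _ h => absurd hzw h
    · exact (((hlU z hz).2.2.1.sub (hlU w hw).2.2.1).eventually_ne (sub_ne_zero.2 hzw)).mono
        fun _ h _ => sub_ne_zero.1 h
  -- At `b` the only roots with `Re z ≥ 0` are imaginary, so nearby unstable roots must lie on one
  -- of the branches.
  have e5 : ∀ᶠ b' in 𝓝 b, ∀ z : ℂ, characteristicFn r τ b' z = 0 → 0 ≤ z.re →
      z ∈ ⋃ w ∈ imagRoots r τ b, U w := by
    refine eventually_roots_mem hr hτ (isOpen_biUnion fun w hw => (hlU w hw).1)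
      fun z hz hre => ?_
    rcases hre.eq_or_lt with h | h
    · have hz' : z ∈ imagRoots r τ b := ⟨hz, h.symm⟩
      exact mem_biUnion hz' (hlU z hz').2.1
    · exact absurd (show z ∈ unstableRoots r τ b from ⟨hz, h⟩) (by rw [hst]; simp)
  filter_upwards [e1, e2, e3, e4, e5] with b' e1 e2 e3 e4 e5 hdir
  have himg : unstableRoots r τ b' = (fun z => l z b') '' imagRoots r τ b := by
    ext w
    constructor
    · rintro ⟨hw, hre⟩
      obtain ⟨z, hz, hwU⟩ := mem_iUnion₂.1 (e5 w hw hre.le)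
      exact ⟨z, hz, ((e1 z hz w hwU).1 hw).symm⟩
    · rintro ⟨z, hz, rfl⟩
      exact ⟨(e1 z hz _ (e3 z hz)).2 rfl, e2 z hz hdir⟩
  rw [himg]
  refine InjOn.ncard_image ?_
  intro z hz w hw h
  by_contra hne
  exact e4 z hz w hw hne h

/-! ### First curve point and loss of stability -/

/-- A slope without imaginary roots keeps this property nearby, because roots with `Re z ≥ 0` stay
in the open set `Re z ≠ 0`. Closedness makes the first crossing slope attained. -/
theorem isClosed_setOf_onCurve {r τ : ℝ} (hr : 0 < r) (hτ : 0 < τ) :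
    IsClosed {b : ℝ | ∃ n, OnCurve r n τ b} := by
  rw [← isOpen_compl_iff, isOpen_iff_eventually]
  intro b hb
  have hU : IsOpen {z : ℂ | z.re ≠ 0} := isOpen_ne.preimage Complex.continuous_re
  have := eventually_roots_mem hr hτ hU (b := b)
    fun z hz _ h0 => hb ((exists_imagRoot_iff hr hτ b).1 ⟨z, hz, h0⟩)
  filter_upwards [this] with b' h hb'
  obtain ⟨z, hz, h0⟩ := (exists_imagRoot_iff hr hτ b').2 hb'
  exact h z hz h0.ge h0

theorem ne_zero_of_onCurve {r τ b : ℝ} {n : ℕ} (h : OnCurve r n τ b) : b ≠ 0 := by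
  obtain ⟨s, hs, -, rfl⟩ := h
  exact one_div_ne_zero (cos_ne_zero_of_mem hs)

theorem even_of_onCurve_pos {r τ b : ℝ} {n : ℕ} (h : OnCurve r n τ b) (hb : 0 < b) : Even n := by
  obtain ⟨s, hs, -, rfl⟩ := h
  by_contra hn
  exact (bC_neg_of_odd hs (Nat.not_even_iff_odd.1 hn)).not_gt hb

theorem odd_of_onCurve_neg {r τ b : ℝ} {n : ℕ} (h : OnCurve r n τ b) (hb : b < 0) : Odd n := by
  obtain ⟨s, hs, -, rfl⟩ := h
  by_contra hn
  exact (bC_pos_of_even hs (Nat.not_odd_iff_even.1 hn)).not_gt hb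

/-- Intermediate value theorem for `s - nπ - arctan (tanValue r τ s)`, which is positive at the
right end because `arctan < π/2`. A zero lies in the `n`-th interval by the range of `arctan`. -/
theorem exists_curve_point_of_left {r τ a : ℝ} {n : ℕ} (hr : 0 < r) (hτ : 0 < τ) (ha : 0 < a)
    (ha' : a < n * Real.pi + Real.pi / 2)
    (h : a - n * Real.pi < Real.arctan (tanValue r τ a)) :
    ∃ s ∈ curveInterval n, τ = tauC r s := by
  have hcont : ContinuousOn (fun s => s - n * Real.pi - Real.arctan (tanValue r τ s))
      (Icc a (n * Real.pi + Real.pi / 2)) := by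
    unfold tanValue
    refine (continuousOn_id.sub continuousOn_const).sub
      (Real.continuous_arctan.comp_continuousOn ?_)
    refine ContinuousOn.sub ?_ (continuousOn_id.div_const τ)
    exact continuousOn_const.div continuousOn_id fun s hs => (ha.trans_le hs.1).ne'
  have hmem : (0 : ℝ) ∈ Ioo (a - n * Real.pi - Real.arctan (tanValue r τ a))
      (n * Real.pi + Real.pi / 2 - n * Real.pi -
        Real.arctan (tanValue r τ (n * Real.pi + Real.pi / 2))) := by
    constructor
    · linarith
    · linarith [Real.arctan_lt_pi_div_two (tanValue r τ (n * Real.pi + Real.pi / 2))]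
  obtain ⟨s, hs, hs0⟩ := intermediate_value_Ioo ha'.le hcont hmem
  have hs' : s - n * Real.pi = Real.arctan (tanValue r τ s) := sub_eq_zero.1 hs0
  have hspos := ha.trans hs.1
  refine ⟨s, mem_curveInterval_iff.2 ⟨hspos, ?_⟩, (eq_tauC_iff hr hτ hspos).2 ?_⟩
  · rw [hs']
    exact Real.arctan_mem_Ioo _
  · rw [← Real.tan_sub_nat_mul_pi s n, hs', Real.tan_arctan, tanValue]

theorem exists_curve_point_zero {r τ : ℝ} (hr : 0 < r) (hτ : 0 < τ) :
    ∃ s ∈ curveInterval 0, τ = tauC r s := by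
  -- `tanValue` has a pole at `0`, so the left end must be positive. The second bound gives
  -- `tanValue ≥ 1`, and `1/2 < π/4 = arctan 1`.
  set a := min (1 / 2) (r * τ ^ 2 / (τ + 1)) with hadef
  have ha : 0 < a := lt_min (by norm_num) (by positivity)
  have ha1 : a ≤ 1 / 2 := min_le_left _ _
  have ha2 : a * (τ + 1) ≤ r * τ ^ 2 := by
    rw [← le_div_iff₀ (by positivity)]
    exact min_le_right _ _
  have hpi := Real.pi_gt_three
  have hg : 1 ≤ tanValue r τ a := by
    unfold tanValue
    rw [div_sub_div _ _ ha.ne' hτ.ne', le_div_iff₀ (by positivity)]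
    nlinarith
  have h1 := Real.arctan_mono hg
  rw [Real.arctan_one] at h1
  refine exists_curve_point_of_left hr hτ ha ?_ ?_ <;> simp <;> linarith

theorem exists_curve_point_one {r τ : ℝ} (hr : 0 < r) (hτ : 0 < τ) :
    ∃ s ∈ curveInterval 1, τ = tauC r s := by
  have hpi := Real.pi_pos
  refine exists_curve_point_of_left hr hτ (a := Real.pi / 2) (by positivity) ?_ ?_
  · simp
    linarith
  · refine lt_of_eq_of_lt ?_ (Real.neg_pi_div_two_lt_arctan _)
    simp
    ring

theorem exists_isLeast_onCurve {r τ : ℝ} (hr : 0 < r) (hτ : 0 < τ) :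
    ∃ b, IsLeast {b : ℝ | 0 < b ∧ ∃ n, OnCurve r n τ b} b := by
  obtain ⟨s, hs, h1⟩ := exists_curve_point_zero hr hτ
  have hb := bC_pos_of_even hs Even.zero
  -- Including `0` makes the interval compact and adds no slope, since slopes on the curves are
  -- nonzero.
  have hC : IsCompact (Icc 0 (bC s) ∩ {b : ℝ | ∃ n, OnCurve r n τ b}) :=
    isCompact_Icc.inter_right (isClosed_setOf_onCurve hr hτ)
  obtain ⟨b, ⟨⟨hb0, hb1⟩, n, hn⟩, hle⟩ :=
    hC.exists_isLeast ⟨bC s, ⟨hb.le, le_rfl⟩, 0, s, hs, h1, rfl⟩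
  refine ⟨b, ⟨lt_of_le_of_ne hb0 (ne_zero_of_onCurve hn).symm, n, hn⟩, ?_⟩
  rintro c ⟨hc0, hc⟩
  rcases le_total c (bC s) with h | h
  · exact hle ⟨⟨hc0.le, h⟩, hc⟩
  · exact hb1.trans h

theorem exists_isGreatest_onCurve {r τ : ℝ} (hr : 0 < r) (hτ : 0 < τ) :
    ∃ b, IsGreatest {b : ℝ | b < 0 ∧ ∃ n, OnCurve r n τ b} b := by
  obtain ⟨s, hs, h1⟩ := exists_curve_point_one hr hτ
  have hb := bC_neg_of_odd hs odd_one
  have hC : IsCompact (Icc (bC s) 0 ∩ {b : ℝ | ∃ n, OnCurve r n τ b}) :=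
    isCompact_Icc.inter_right (isClosed_setOf_onCurve hr hτ)
  obtain ⟨b, ⟨⟨hb0, hb1⟩, n, hn⟩, hle⟩ :=
    hC.exists_isGreatest ⟨bC s, ⟨le_rfl, hb.le⟩, 1, s, hs, h1, rfl⟩
  refine ⟨b, ⟨lt_of_le_of_ne hb1 (ne_zero_of_onCurve hn), n, hn⟩, ?_⟩
  rintro c ⟨hc0, hc⟩
  rcases le_total (bC s) c with h | h
  · exact hle ⟨⟨h, hc0.le⟩, hc⟩
  · exact h.trans hb0

theorem isStable_iff {r : ℝ} (hr : 0 < r) (τ b : ℝ) :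
    IsStable r τ b ↔ ∀ z : ℂ, characteristicFn r τ b z = 0 → z.re < 0 := by
  simp only [IsStable, isEigenvalue_iff hr]

theorem exists_unstable_eigenvalue {r τ b : ℝ} (hr : 0 < r)
    (h : (unstableRoots r τ b).ncard ≠ 0) : ∃ z : ℂ, IsEigenvalue r τ b z ∧ 0 < z.re := by
  obtain ⟨z, hz, hre⟩ := nonempty_of_ncard_ne_zero h
  exact ⟨z, (isEigenvalue_iff hr τ b z).2 hz, hre⟩

/-- The number of unstable roots just beyond the end `b` of an interval of stability. -/
theorem eventually_ncard_of_mem_closure {r τ b : ℝ} (hr : 0 < r) (hτ : 0 < τ) {S : Set ℝ}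
    (hS : ∀ b' ∈ S, IsStable r τ b') (hb : b ∈ closure S) :
    ∀ᶠ b' in 𝓝 b, 0 < b * (b' - b) →
      (unstableRoots r τ b').ncard = (imagRoots r τ b).ncard :=
  eventually_ncard_unstableRoots hr hτ <| unstableRoots_eq_empty_of_frequently_stable hr hτ <|
    (mem_closure_iff_frequently.1 hb).mono fun b' hb' => (isStable_iff hr τ b').1 (hS b' hb')

theorem imagRoots_ncard_ne_zero {r τ b : ℝ} (hr : 0 < r) (hτ : 0 < τ)
    (h : ∃ n, OnCurve r n τ b) : (imagRoots r τ b).ncard ≠ 0 := by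
  rcases isHopfPoint_or_isDoubleHopfPoint hr hτ h with h | h
  · rw [h.ncard_imagRoots]
    norm_num
  · rw [h.ncard_imagRoots]
    norm_num

theorem losesStabilityUp_of_isLeast {r τ b : ℝ} (hr : 0 < r) (hτ : 0 < τ)
    (hb : IsLeast {b : ℝ | 0 < b ∧ ∃ n, OnCurve r n τ b} b) :
    LosesStabilityUp r τ b ∧
      ∀ᶠ b' in 𝓝[>] b, (unstableRoots r τ b').ncard = (imagRoots r τ b).ncard := by
  obtain ⟨⟨hb0, hcurve⟩, hle⟩ := hb
  have hst : ∀ b' ∈ Ico 0 b, IsStable r τ b' := by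
    simp only [isStable_iff hr]
    refine stable_of_forall_not_onCurve hr hτ isPreconnected_Ico ⟨le_rfl, hb0⟩ fun c hc n hn => ?_
    exact (hle ⟨lt_of_le_of_ne hc.1 (ne_zero_of_onCurve hn).symm, n, hn⟩).not_gt hc.2
  have hcl : b ∈ closure (Ico 0 b) := by
    rw [closure_Ico hb0.ne]
    exact ⟨hb0.le, le_rfl⟩
  have hcard : ∀ᶠ b' in 𝓝[>] b, (unstableRoots r τ b').ncard = (imagRoots r τ b).ncard := by
    rw [eventually_nhdsWithin_iff]
    filter_upwards [eventually_ncard_of_mem_closure hr hτ hst hcl] with b' h hb'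
    exact h (mul_pos hb0 (sub_pos.2 hb'))
  refine ⟨⟨hb0, hst, ?_⟩, hcard⟩
  filter_upwards [hcard] with b' h
  exact exists_unstable_eigenvalue hr (h ▸ imagRoots_ncard_ne_zero hr hτ hcurve)

theorem losesStabilityDown_of_isGreatest {r τ b : ℝ} (hr : 0 < r) (hτ : 0 < τ)
    (hb : IsGreatest {b : ℝ | b < 0 ∧ ∃ n, OnCurve r n τ b} b) :
    LosesStabilityDown r τ b ∧
      ∀ᶠ b' in 𝓝[<] b, (unstableRoots r τ b').ncard = (imagRoots r τ b).ncard := by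
  obtain ⟨⟨hb0, hcurve⟩, hle⟩ := hb
  have hst : ∀ b' ∈ Ioc b 0, IsStable r τ b' := by
    simp only [isStable_iff hr]
    refine stable_of_forall_not_onCurve hr hτ isPreconnected_Ioc ⟨hb0, le_rfl⟩ fun c hc n hn => ?_
    exact (hle ⟨lt_of_le_of_ne hc.2 (ne_zero_of_onCurve hn), n, hn⟩).not_gt hc.1
  have hcl : b ∈ closure (Ioc b 0) := by
    rw [closure_Ioc hb0.ne]
    exact ⟨le_rfl, hb0.le⟩
  have hcard : ∀ᶠ b' in 𝓝[<] b, (unstableRoots r τ b').ncard = (imagRoots r τ b).ncard := by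
    rw [eventually_nhdsWithin_iff]
    filter_upwards [eventually_ncard_of_mem_closure hr hτ hst hcl] with b' h hb'
    exact h (mul_pos_of_neg_of_neg hb0 (sub_neg.2 hb'))
  refine ⟨⟨hb0, hst, ?_⟩, hcard⟩
  filter_upwards [hcard] with b' h
  exact exists_unstable_eigenvalue hr (h ▸ imagRoots_ncard_ne_zero hr hτ hcurve)

theorem exists_losesStabilityUp {r τ : ℝ} (hr : 0 < r) (hτ : 0 < τ) :
    ∃ b : ℝ, LosesStabilityUp r τ b ∧
      ((IsHopfPoint r τ b ∧ ∀ᶠ b' in 𝓝[>] b, (unstableRoots r τ b').ncard = 2) ∨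
        (IsDoubleHopfPoint r τ b ∧ ∀ᶠ b' in 𝓝[>] b, (unstableRoots r τ b').ncard = 4)) := by
  obtain ⟨b, hb⟩ := exists_isLeast_onCurve hr hτ
  obtain ⟨h1, h2⟩ := losesStabilityUp_of_isLeast hr hτ hb
  refine ⟨b, h1, ?_⟩
  rcases isHopfPoint_or_isDoubleHopfPoint hr hτ hb.1.2 with h | h
  · exact Or.inl ⟨h, by rwa [h.ncard_imagRoots] at h2⟩
  · exact Or.inr ⟨h, by rwa [h.ncard_imagRoots] at h2⟩

theorem exists_losesStabilityDown {r τ : ℝ} (hr : 0 < r) (hτ : 0 < τ) :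
    ∃ b : ℝ, LosesStabilityDown r τ b ∧
      ((IsHopfPoint r τ b ∧ ∀ᶠ b' in 𝓝[<] b, (unstableRoots r τ b').ncard = 2) ∨
        (IsDoubleHopfPoint r τ b ∧ ∀ᶠ b' in 𝓝[<] b, (unstableRoots r τ b').ncard = 4)) := by
  obtain ⟨b, hb⟩ := exists_isGreatest_onCurve hr hτ
  obtain ⟨h1, h2⟩ := losesStabilityDown_of_isGreatest hr hτ hb
  refine ⟨b, h1, ?_⟩
  rcases isHopfPoint_or_isDoubleHopfPoint hr hτ hb.1.2 with h | h
  · exact Or.inl ⟨h, by rwa [h.ncard_imagRoots] at h2⟩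
  · exact Or.inr ⟨h, by rwa [h.ncard_imagRoots] at h2⟩

/-! ### Countability of the double-Hopf delays -/

/-- The parameters of an intersection of two curves add up to `(n + m)π`. -/
theorem add_eq_of_meet {r τ b s t : ℝ} {n m : ℕ} (hr : 0 < r) (hτ : 0 < τ) (hnm : n ≠ m)
    (hs : s ∈ curveInterval n) (ht : t ∈ curveInterval m)
    (h1 : τ = tauC r s) (h2 : τ = tauC r t) (h3 : b = bC s) (h4 : b = bC t) :
    s + t = (n + m) * Real.pi := by
  have hst : s ≠ t := fun h => hnm (curveInterval_index_unique hs (h ▸ ht))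
  have h := tanValue_neg_of_meet hr hτ hs ht hst h1 h2 h3 h4
  unfold tanValue at h
  rw [← (eq_tauC_iff hr hτ (pos_of_mem_curveInterval hs)).1 h1,
    ← (eq_tauC_iff hr hτ (pos_of_mem_curveInterval ht)).1 h2,
    ← Real.tan_sub_nat_mul_pi s n, ← Real.tan_sub_nat_mul_pi t m, ← Real.tan_neg] at h
  have hs' := (mem_curveInterval_iff.1 hs).2
  have ht' := (mem_curveInterval_iff.1 ht).2
  -- Opposite tangents on the principal branch give `s - nπ = -(t - mπ)`.
  have := Real.injOn_tan hs' ⟨by linarith [ht'.2], by linarith [ht'.1]⟩ h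
  linarith

/-- A larger delay would increase both parameters, whose sum is fixed by `add_eq_of_meet`. -/
theorem subsingleton_meet {r : ℝ} (hr : 0 < r) {n m : ℕ} (hnm : n ≠ m) :
    {τ : ℝ | 0 < τ ∧ ∃ b, OnCurve r n τ b ∧ OnCurve r m τ b}.Subsingleton := by
  have key : ∀ τ ∈ {τ : ℝ | 0 < τ ∧ ∃ b, OnCurve r n τ b ∧ OnCurve r m τ b},
      ∀ τ' ∈ {τ : ℝ | 0 < τ ∧ ∃ b, OnCurve r n τ b ∧ OnCurve r m τ b}, ¬ τ < τ' := by
    rintro τ ⟨hτ, b, ⟨s, hs, s1, s2⟩, ⟨t, ht, t1, t2⟩⟩ τ'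
      ⟨hτ', b', ⟨s', hs', s1', s2'⟩, ⟨t', ht', t1', t2'⟩⟩ hlt
    have e := add_eq_of_meet hr hτ hnm hs ht s1 t1 s2 t2
    have e' := add_eq_of_meet hr hτ' hnm hs' ht' s1' t1' s2' t2'
    have h1 : s < s' := ((tauC_strictMonoOn hr n).lt_iff_lt hs hs').1 (by rwa [← s1, ← s1'])
    have h2 : t < t' := ((tauC_strictMonoOn hr m).lt_iff_lt ht ht').1 (by rwa [← t1, ← t1'])
    linarith
  intro τ h τ' h'
  exact le_antisymm (not_lt.1 (key _ h' _ h)) (not_lt.1 (key _ h _ h'))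

theorem countable_doubleHopf_delays {r : ℝ} (hr : 0 < r) :
    {τ : ℝ | 0 < τ ∧ ∃ b, IsDoubleHopfPoint r τ b}.Countable := by
  have : {τ : ℝ | 0 < τ ∧ ∃ b, IsDoubleHopfPoint r τ b} ⊆
      ⋃ p ∈ {p : ℕ × ℕ | p.1 ≠ p.2},
        {τ : ℝ | 0 < τ ∧ ∃ b, OnCurve r p.1 τ b ∧ OnCurve r p.2 τ b} := by
    rintro τ ⟨hτ, b, hb⟩
    obtain ⟨n, m, hnm, h⟩ := (isDoubleHopfPoint_iff hr hτ b).1 hb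
    exact mem_biUnion (show (n, m) ∈ {p : ℕ × ℕ | p.1 ≠ p.2} from hnm) ⟨hτ, b, h⟩
  exact ((to_countable _).biUnion fun p hp => (subsingleton_meet hr hp).countable).mono this

theorem tauPlus_countable {r : ℝ} (hr : 0 < r) : (tauPlus r).Countable :=
  by
  refine (countable_doubleHopf_delays hr).mono ?_
  rintro τ ⟨hτ, b, -, h⟩
  exact ⟨hτ, b, h⟩

theorem tauMinus_countable {r : ℝ} (hr : 0 < r) : (tauMinus r).Countable :=
  by
  refine (countable_doubleHopf_delays hr).mono ?_
  rintro τ ⟨hτ, b, -, h⟩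
  exact ⟨hτ, b, h⟩

/-! ### Infinitely many double-Hopf delays -/

/-- The offset of the intersection of the curves `N` and `N + 2`. -/
theorem exists_offset {r : ℝ} (hr : 0 < r) {N : ℕ} (hN : 1 ≤ N) :
    ∃ δ ∈ Ioo 0 (Real.pi / 2), Real.tan δ =
      √r * (2 * Real.pi - 2 * δ) / √((N * Real.pi + δ) * ((N + 2) * Real.pi - δ)) := by
  have hpi := Real.pi_pos
  have hN' : (1 : ℝ) ≤ N := by exact_mod_cast hN
  have hposP : ∀ δ ∈ Icc 0 (Real.pi / 2),
      0 < √((N * Real.pi + δ) * ((N + 2) * Real.pi - δ)) := by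
    intro δ hδ
    refine Real.sqrt_pos.2 (mul_pos ?_ ?_) <;> nlinarith [hδ.1, hδ.2]
  -- For `s = Nπ + δ` and `t = (N + 2)π - δ`, opposite values of `tanValue` mean `rτ² = st`; the
  -- value at `s` is then `√r (t - s) / √(st)`, which has to equal `tan δ`. `N ≥ 1` keeps the root
  -- positive at `δ = 0`.
  set h : ℝ → ℝ := fun δ =>
    √r * (2 * Real.pi - 2 * δ) / √((N * Real.pi + δ) * ((N + 2) * Real.pi - δ)) with hdef
  have hcont : ContinuousOn (fun δ => δ - Real.arctan (h δ)) (Icc 0 (Real.pi / 2)) := by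
    refine continuousOn_id.sub (Real.continuous_arctan.comp_continuousOn ?_)
    exact ContinuousOn.div (by fun_prop) (by fun_prop) fun δ hδ => (hposP δ hδ).ne'
  have h0 : 0 < h 0 := div_pos (mul_pos (Real.sqrt_pos.2 hr) (by linarith))
    (hposP 0 ⟨le_rfl, by positivity⟩)
  obtain ⟨δ, hδ, hδ0⟩ := intermediate_value_Ioo (by positivity) hcont
    (show (0 : ℝ) ∈ Ioo _ _ from ⟨by simpa using Real.arctan_pos.2 h0,
      by linarith [Real.arctan_lt_pi_div_two (h (Real.pi / 2))]⟩)
  refine ⟨δ, hδ, ?_⟩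
  rw [show δ = Real.arctan (h δ) from sub_eq_zero.1 hδ0, Real.tan_arctan,
    ← show δ = Real.arctan (h δ) from sub_eq_zero.1 hδ0]

/-- The curves `N` and `N + 2` meet at a point with the least modulus of the slope among all
points with the same delay on curves with indices of the same parity. -/
theorem exists_extremal_meet {r : ℝ} (hr : 0 < r) {N : ℕ} (hN : 1 ≤ N) :
    ∃ τ b, 0 < τ ∧ OnCurve r N τ b ∧ OnCurve r (N + 2) τ b ∧
      ∀ n b', (Even n ↔ Even N) → OnCurve r n τ b' → b ^ 2 ≤ b' ^ 2 := by
  obtain ⟨δ, ⟨hδ0, hδ1⟩, htan⟩ := exists_offset hr hN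
  have hpi := Real.pi_pos
  have hN' : (1 : ℝ) ≤ N := by exact_mod_cast hN
  set s := N * Real.pi + δ with hsdef
  set t := (N + 2) * Real.pi - δ with htdef
  have hs0 : 0 < s := by positivity
  have ht0 : 0 < t := by nlinarith
  have hs : s ∈ curveInterval N :=
    mem_curveInterval_iff.2 ⟨hs0, by rw [hsdef]; constructor <;> linarith⟩
  have ht : t ∈ curveInterval (N + 2) :=
    mem_curveInterval_iff.2 ⟨ht0, by rw [htdef]; push_cast; constructor <;> linarith⟩
  set P := √(s * t) with hPdef
  set R := √r with hRdef
  have hP : 0 < P := Real.sqrt_pos.2 (by positivity)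
  have hR : 0 < R := Real.sqrt_pos.2 hr
  have hP2 : P ^ 2 = s * t := Real.sq_sqrt (by positivity)
  have hR2 : R ^ 2 = r := Real.sq_sqrt hr.le
  have hτ : 0 < P / R := by positivity
  have hts : 2 * Real.pi - 2 * δ = t - s := by rw [hsdef, htdef]; ring
  rw [hts] at htan
  have es : tanValue r (P / R) s = Real.tan δ := by
    rw [htan, tanValue, ← hR2]
    field_simp
    linear_combination hP2
  have et : tanValue r (P / R) t = -Real.tan δ := by
    rw [htan, tanValue, ← hR2]
    field_simp
    linear_combination hP2
  have hs1 : P / R = tauC r s := by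
    rw [eq_tauC_iff hr hτ hs0, ← tanValue, es, ← Real.tan_sub_nat_mul_pi s N, hsdef]
    ring_nf
  have ht1 : P / R = tauC r t := by
    rw [eq_tauC_iff hr hτ ht0, ← tanValue, et, ← Real.tan_sub_nat_mul_pi t (N + 2), htdef,
      ← Real.tan_neg]
    push_cast
    ring_nf
  have hb : bC s = bC t := by
    rw [bC_eq N, bC_eq (N + 2) t, pow_add, htdef, hsdef, ← Real.cos_neg]
    push_cast
    ring_nf
  refine ⟨P / R, bC s, hτ, ⟨s, hs, hs1, rfl⟩, ⟨t, ht, ht1, hb⟩, ?_⟩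
  rintro n b' hpar ⟨u, hu, u1, rfl⟩
  have htanpos : 0 < Real.tan δ := Real.tan_pos_of_pos_of_lt_pi_div_two hδ0 hδ1
  have hu0 := pos_of_mem_curveInterval hu
  rw [bC_sq_of_tauC hr hτ hs hs1, bC_sq_of_tauC hr hτ hu u1, es]
  -- Monotonicity gives `tanValue ≥ tan δ` to the left of `s` and `tanValue ≤ -tan δ` to the right
  -- of `t`, so the slope has no smaller modulus there.
  rcases le_or_gt u s with h | h
  · have : tanValue r (P / R) s ≤ tanValue r (P / R) u := by
      rcases h.eq_or_lt with h | h
      · rw [h]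
      · exact (tanValue_lt hr hτ hu0 h).le
    rw [es] at this
    nlinarith
  rcases le_or_gt t u with h' | h'
  · have : tanValue r (P / R) u ≤ tanValue r (P / R) t := by
      rcases h'.eq_or_lt with h | h
      · rw [h]
      · exact (tanValue_lt hr hτ ht0 h).le
    rw [et] at this
    nlinarith
  -- Strictly between `s` and `t`, parity leaves only the curves `N` and `N + 2`, each of which has
  -- a single point with this delay.
  exfalso
  obtain ⟨-, hu1, hu2⟩ := mem_curveInterval_iff.1 hu
  have hn1 : (N : ℝ) < n + 1 := by
    by_contra! hc
    nlinarith
  have hn2 : (n : ℝ) < N + 2 + 1 := by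
    by_contra! hc
    nlinarith
  have hn1' : N < n + 1 := by exact_mod_cast hn1
  have hn2' : n < N + 2 + 1 := by exact_mod_cast hn2
  rw [Nat.even_iff, Nat.even_iff] at hpar
  have : n = N ∨ n = N + 2 := by omega
  rcases this with rfl | rfl
  · exact h.ne (curve_parameter_unique hr hs hu (hs1.symm.trans u1))
  · exact h'.ne (curve_parameter_unique hr hu ht (u1.symm.trans ht1))

/-- At most two curves pass through a point, so the pairs `{N, N + 2}` and `{M, M + 2}` agree. This
separates the delays found for different indices. -/
theorem index_eq_of_common_meet {r τ b : ℝ} (hr : 0 < r) (hτ : 0 < τ) {N M : ℕ}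
    (h1 : OnCurve r N τ b) (h2 : OnCurve r (N + 2) τ b) (h3 : OnCurve r M τ b)
    (h4 : OnCurve r (M + 2) τ b) : N = M := by
  by_contra hne
  have e1 := not_three_curves hr hτ (show N ≠ N + 2 by omega) hne h1 h2 h3
  subst e1
  have e2 := not_three_curves hr hτ (show N ≠ N + 2 by omega) (show N ≠ N + 2 + 2 by omega)
    h1 h2 h4
  omega

theorem tauPlus_infinite {r : ℝ} (hr : 0 < r) : (tauPlus r).Infinite := by
  -- Positive slopes occur only on even curves, so least modulus within the parity means least
  -- positive slope. The indices start at `2` because `exists_extremal_meet` needs `N ≥ 1`.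
  have h : ∀ k : ℕ, ∃ τ b, 0 < τ ∧ OnCurve r (2 * k + 2) τ b ∧ OnCurve r (2 * k + 2 + 2) τ b ∧
      IsLeast {b : ℝ | 0 < b ∧ ∃ n, OnCurve r n τ b} b := by
    intro k
    obtain ⟨τ, b, hτ, h1, h2, hmin⟩ := exists_extremal_meet hr (show 1 ≤ 2 * k + 2 by omega)
    have hb : 0 < b := by
      obtain ⟨s, hs, -, rfl⟩ := h1
      exact bC_pos_of_even hs ⟨k + 1, by ring⟩
    refine ⟨τ, b, hτ, h1, h2, ⟨hb, _, h1⟩, ?_⟩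
    rintro c ⟨hc, n, hn⟩
    have hpar : Even n ↔ Even (2 * k + 2) :=
      iff_of_true (even_of_onCurve_pos hn hc) (even_of_onCurve_pos h1 hb)
    nlinarith [hmin n c hpar hn]
  choose τ b hτ h1 h2 hl using h
  refine infinite_of_injective_forall_mem (f := τ) ?_ fun k => ⟨hτ k, b k,
    (losesStabilityUp_of_isLeast hr (hτ k) (hl k)).1, (isDoubleHopfPoint_iff hr (hτ k) (b k)).2
      ⟨_, _, by omega, h1 k, h2 k⟩⟩
  intro k j hkj
  -- The delay determines the least slope, so equal delays give the same point and hence the same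
  -- pair of curves.
  have hbb : b k = b j := (hl k).unique (hkj ▸ hl j)
  have := index_eq_of_common_meet hr (hτ k) (h1 k) (h2 k)
    (by rw [hkj, hbb]; exact h1 j) (by rw [hkj, hbb]; exact h2 j)
  omega

theorem tauMinus_infinite {r : ℝ} (hr : 0 < r) : (tauMinus r).Infinite := by
  have h : ∀ k : ℕ, ∃ τ b, 0 < τ ∧ OnCurve r (2 * k + 1) τ b ∧ OnCurve r (2 * k + 1 + 2) τ b ∧
      IsGreatest {b : ℝ | b < 0 ∧ ∃ n, OnCurve r n τ b} b := by
    intro k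
    obtain ⟨τ, b, hτ, h1, h2, hmin⟩ := exists_extremal_meet hr (show 1 ≤ 2 * k + 1 by omega)
    have hb : b < 0 := by
      obtain ⟨s, hs, -, rfl⟩ := h1
      exact bC_neg_of_odd hs ⟨k, rfl⟩
    refine ⟨τ, b, hτ, h1, h2, ⟨hb, _, h1⟩, ?_⟩
    rintro c ⟨hc, n, hn⟩
    have hpar : Even n ↔ Even (2 * k + 1) := iff_of_false
      (Nat.not_even_iff_odd.2 (odd_of_onCurve_neg hn hc))
      (Nat.not_even_iff_odd.2 (odd_of_onCurve_neg h1 hb))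
    nlinarith [hmin n c hpar hn]
  choose τ b hτ h1 h2 hl using h
  refine infinite_of_injective_forall_mem (f := τ) ?_ fun k => ⟨hτ k, b k,
    (losesStabilityDown_of_isGreatest hr (hτ k) (hl k)).1,
    (isDoubleHopfPoint_iff hr (hτ k) (b k)).2 ⟨_, _, by omega, h1 k, h2 k⟩⟩
  intro k j hkj
  have hbb : b k = b j := (hl k).unique (hkj ▸ hl j)
  have := index_eq_of_common_meet hr (hτ k) (h1 k) (h2 k)
    (by rw [hkj, hbb]; exact h1 j) (by rw [hkj, hbb]; exact h2 j)
  omega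

end BandLimited

theorem mainTheorem6 (r : ℝ) (hr : 0 < r) :
    -- the linearisation at the steady state, with effective slope `γ f'(0)`
    (∀ (γ : ℝ) (f : ℝ → ℝ), f 0 = 0 → DifferentiableAt ℝ f 0 →
      modelField r γ f 0 = 0 ∧
      ∃ A : ℝ × ℝ × ℝ →L[ℝ] ℝ × ℝ, HasFDerivAt (modelField r γ f) A 0 ∧
        ∀ p, A p = linearField r (γ * deriv f 0) p) ∧
    -- its eigenvalues are the roots of the characteristic equation
    (∀ (τ b : ℝ) (z : ℂ), 0 < τ → (IsEigenvalue r τ b z ↔ characteristicFn r τ b z = 0)) ∧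
    -- there is no zero root
    (∀ τ b : ℝ, 0 < τ → characteristicFn r τ b 0 ≠ 0) ∧
    -- purely imaginary roots occur exactly on the curves, with `s = |Ω| τ`
    (∀ τ b Ω : ℝ, 0 < τ →
      (characteristicFn r τ b (Ω * Complex.I) = 0 ↔
        ∃ n : ℕ, |Ω| * τ ∈ curveInterval n ∧ τ = tauC r (|Ω| * τ) ∧ b = bC (|Ω| * τ))) ∧
    (∀ τ b : ℝ, 0 < τ →
      ((∃ z : ℂ, characteristicFn r τ b z = 0 ∧ z.re = 0) ↔ ∃ n : ℕ, OnCurve r n τ b)) ∧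
    -- the sign of the slope on the curves
    (∀ n : ℕ, ∀ s ∈ curveInterval n, (Even n → 0 < bC s) ∧ (Odd n → bC s < 0)) ∧
    -- simple roots and transversal crossing along the curves
    (∀ n : ℕ, ∀ s ∈ curveInterval n, 0 < tauC r s ∧
      ∀ z : ℂ, (z = ((s / tauC r s : ℝ) : ℂ) * Complex.I ∨
          z = -(((s / tauC r s : ℝ) : ℂ) * Complex.I)) →
        IsSimpleRoot r (tauC r s) (bC s) z ∧
        ∃ l : ℝ → ℂ, IsRootBranch r (tauC r s) (bC s) z l ∧
          (deriv l (bC s)).re = crossingSpeed r s ∧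
          (deriv l (bC s)).re ≠ 0 ∧
          SignType.sign (deriv l (bC s)).re = SignType.sign (bC s)) ∧
    -- Hopf points lie on exactly one curve, double-Hopf points are the intersections
    (∀ τ b : ℝ, 0 < τ → (IsHopfPoint r τ b ↔ ∃! n : ℕ, OnCurve r n τ b)) ∧
    (∀ τ b : ℝ, 0 < τ →
      (IsDoubleHopfPoint r τ b ↔ ∃ n m : ℕ, n ≠ m ∧ OnCurve r n τ b ∧ OnCurve r m τ b)) ∧
    -- loss of stability for increasing slope
    (∀ τ : ℝ, 0 < τ → ∃ b : ℝ, LosesStabilityUp r τ b ∧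
      ((IsHopfPoint r τ b ∧ ∀ᶠ b' in 𝓝[>] b, (unstableRoots r τ b').ncard = 2) ∨
        (IsDoubleHopfPoint r τ b ∧ ∀ᶠ b' in 𝓝[>] b, (unstableRoots r τ b').ncard = 4))) ∧
    (∀ τ : ℝ, 0 < τ → τ ∉ tauPlus r → ∃ b : ℝ, LosesStabilityUp r τ b ∧ IsHopfPoint r τ b) ∧
    (tauPlus r).Countable ∧ (tauPlus r).Infinite ∧ volume (tauPlus r) = 0 ∧
    -- loss of stability for decreasing slope
    (∀ τ : ℝ, 0 < τ → ∃ b : ℝ, LosesStabilityDown r τ b ∧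
      ((IsHopfPoint r τ b ∧ ∀ᶠ b' in 𝓝[<] b, (unstableRoots r τ b').ncard = 2) ∨
        (IsDoubleHopfPoint r τ b ∧ ∀ᶠ b' in 𝓝[<] b, (unstableRoots r τ b').ncard = 4))) ∧
    (∀ τ : ℝ, 0 < τ → τ ∉ tauMinus r →
      ∃ b : ℝ, LosesStabilityDown r τ b ∧ IsHopfPoint r τ b) ∧
    (tauMinus r).Countable ∧ (tauMinus r).Infinite ∧ volume (tauMinus r) = 0 := by
  refine ⟨modelField_linearisation r, fun τ b z _ => isEigenvalue_iff hr τ b z,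
    fun τ b _ => characteristicFn_zero_ne hr τ b,
    fun τ b Ω hτ => characteristicFn_imag_iff hr hτ b Ω,
    fun τ b hτ => exists_imagRoot_iff hr hτ b,
    fun n s hs => ⟨bC_pos_of_even hs, bC_neg_of_odd hs⟩,
    fun n s hs => ⟨tauC_pos hr (pos_of_mem_curveInterval hs),
      fun z hz => curve_root_crossing hr hs hz⟩,
    fun τ b hτ => isHopfPoint_iff hr hτ b, fun τ b hτ => isDoubleHopfPoint_iff hr hτ b,
    fun τ hτ => exists_losesStabilityUp hr hτ, fun τ hτ hτ' => ?_,
    tauPlus_countable hr, tauPlus_infinite hr, (tauPlus_countable hr).measure_zero _,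
    fun τ hτ => exists_losesStabilityDown hr hτ, fun τ hτ hτ' => ?_,
    tauMinus_countable hr, tauMinus_infinite hr, (tauMinus_countable hr).measure_zero _⟩
  · obtain ⟨b, h, h' | h'⟩ := exists_losesStabilityUp hr hτ
    · exact ⟨b, h, h'.1⟩
    · exact absurd ⟨hτ, b, h, h'.1⟩ hτ'
  · obtain ⟨b, h, h' | h'⟩ := exists_losesStabilityDown hr hτ
    · exact ⟨b, h, h'.1⟩
    · exact absurd ⟨hτ, b, h, h'.1⟩ hτ'
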